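/- Let $\Delta\subset\mathbb R^2$ be a Delzant polygon: a nonempty convex hull of finitely many points such that at every vertex exactly two edges meet and these point in the directions of a $\mathbb Z$-basis $e_1,e_2$ of $\mathbb Z^2$, which we list so that $\det(e_1,e_2)=1$. Let $M$ be the associated smooth toric surface. It is the complex surface covered by one patch $\mathbb C^2$, with coordinates $(z^1,z^2)$, for each vertex; $z^a$ is the character $e_a$ of the torus $(\mathbb C^\times)^2$, so the coordinates $\tilde z^a$ at another vertex with basis $\tilde e_a=\sum_b A_{ab}e_b$ are $\tilde z^a=\prod_b (z^b)^{A_{ab}}$. On the holomorphic cotangent bundle $T^*M$ let $(z^1,z^2;\xi_1,\xi_2)$ denote the covector $\xi_1dz^1+\xi_2dz^2$ at the point $(z^1,z^2)$ of a patch. There is a holomorphic Poisson structure $\sigma$ on $M$ which in every patch reads $\sigma=i\,z^1z^2\,\partial_{z^1}\wedge\partial_{z^2}$. It integrates to a holomorphic symplectic groupoid $(X,\Omega_0)$ over $M$ whose space of arrows $X$ is the holomorphic cotangent bundle $T^*M$ (in particular $X$ is diffeomorphic to it). That is: $\mathtt s,\mathtt t:X\to M$ are the source and target of a groupoid all of whose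 structure maps are holomorphic and for which $\mathtt s,\mathtt t$ are surjective submersions; $\Omega_0$ is a holomorphic symplectic form with $m^*\Omega_0=\mathrm{pr}_1^*\Omega_0+\mathrm{pr}_2^*\Omega_0$ on composable pairs, $m$ being the multiplication; with $\Pi=\Omega_0^{-1}$ (inverse matrices) one has $\mathtt t_*\Pi=\sigma$ and $\mathtt s_*\Pi=-\sigma$; the fibres of $\mathtt s$ and $\mathtt t$ are connected and simply connected; and $\ker\mathtt t_*$ is the $\Omega_0$-orthogonal complement of $\ker\mathtt s_*$. Moreover, in every patch: 1. $i\Omega_0=-\xi_1\xi_2\,dz^1\wedge dz^2-\xi_1z^2\,dz^1\wedge d\xi_2+dz^1\wedge d\xi_1+dz^2\wedge d\xi_2+\xi_2z^1\,dz^2\wedge d\xi_1-z^1z^2\,d\xi_1\wedge d\xi_2$; 2. $-i\Pi=\partial_{\xi_1}\wedge\partial_{z^1}+\partial_{\xi_2}\wedge\partial_{z^2}-\xi_1\xi_2\,\partial_{\xi_1}\wedge\partial_{\xi_2}+\xi_1z^2\,\partial_{\xi_1}\wedge\partial_{z^2}-\xi_2z^1\,\partial_{\xi_2}\wedge\partial_{z^1}-z^1z^2\,\partial_{z^1}\wedge\partial_{z^2}$;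 3. for $g=(z^1,z^2;\xi_1,\xi_2)$: $\mathtt s(g)=(z^1,z^2)$ and $\mathtt t(g)=(z^1e^{\xi_2z^2},\,z^2e^{-\xi_1z^1})$; 4. for $h=(z^1e^{\xi_2z^2},z^2e^{-\xi_1z^1};\eta_1,\eta_2)$, so that $\mathtt s(h)=\mathtt t(g)$: $h\circ g=(z^1,z^2;\ \xi_1+\eta_1e^{\xi_2z^2},\ \xi_2+\eta_2e^{-\xi_1z^1})$. -/

import Mathlib

open scoped Manifold ContDiff Matrix
open Set

noncomputable section
namespace ToricPoisson

/-- The segment `[p, q]` is an edge (a one-dimensional exposed face) of `Δ` issuing from `p`. -/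
def IsEdge (Δ : Set (Fin 2 → ℝ)) (p q : Fin 2 → ℝ) : Prop :=
  p ≠ q ∧ IsExposed ℝ Δ (segment ℝ p q)

/-- There are exactly two edges of `Δ` at the vertex `p`, and they point in the directions of the
rows of the integral matrix `E`. As `det E = 1`, the rows are a `ℤ`-basis of `ℤ²`, and they are
listed in positive orientation. -/
def IsEdgeFrame (Δ : Set (Fin 2 → ℝ)) (p : Fin 2 → ℝ)
    (E : Matrix.SpecialLinearGroup (Fin 2) ℤ) : Prop :=
  ∃ q : Fin 2 → Fin 2 → ℝ, (∀ r, IsEdge Δ p r ↔ ∃ a, r = q a) ∧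
    ∀ a, ∃ t : ℝ, 0 < t ∧ q a = p + t • fun i => (E.1 a i : ℝ)

/-- Delzant polygons. -/
structure IsDelzant (Δ : Set (Fin 2 → ℝ)) : Prop where
  nonempty : Δ.Nonempty
  polytope : ∃ S : Set (Fin 2 → ℝ), S.Finite ∧ Δ = convexHull ℝ S
  smooth : ∀ p ∈ Δ.extremePoints ℝ, ∃ E, IsEdgeFrame Δ p E

/-- A corner of `Δ`: a vertex together with its (unique) frame of primitive edge vectors. -/
structure Corner (Δ : Set (Fin 2 → ℝ)) where
  vertex : Fin 2 → ℝ
  frame : Matrix.SpecialLinearGroup (Fin 2) ℤ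
  mem : vertex ∈ Δ.extremePoints ℝ
  isFrame : IsEdgeFrame Δ vertex frame

/-- The coefficients of `m ∈ ℤ²` in the basis given by the rows of `E`. -/
def exponent (E : Matrix.SpecialLinearGroup (Fin 2) ℤ) (m : Fin 2 → ℤ) : Fin 2 → ℤ :=
  m ᵥ* (E⁻¹).1

open Classical in
/-- The value of the character `m` of the torus `(ℂˣ)²` at the point `z` of the affine patch `ℂ²`
of a corner with frame `E`; here the coordinate `z_a` is the character `E a`, so that the character
`m = ∑ k_b E_b` is the monomial `∏ z_b ^ k_b`. The value is `none` where this monomial is not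
regular. -/
def charValue (E : Matrix.SpecialLinearGroup (Fin 2) ℤ) (z : Fin 2 → ℂ) (m : Fin 2 → ℤ) :
    Option ℂ :=
  if ∀ b, z b = 0 → 0 ≤ exponent E m b then some (∏ b, z b ^ exponent E m b) else none

/-- The toric surface of `Δ`: the patches `ℂ²` of all corners, where points of two patches are
identified if the same characters are regular at both points, with the same values. -/
def ToricSurface (Δ : Set (Fin 2 → ℝ)) : Type :=
  {x : (Fin 2 → ℤ) → Option ℂ // ∃ (c : Corner Δ) (z : Fin 2 → ℂ), x = charValue c.frame z}

/-! ### Changes of coordinates -/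

section gluing

variable (E E' E'' : Matrix.SpecialLinearGroup (Fin 2) ℤ)

lemma exponent_vecMul (k : Fin 2 → ℤ) : exponent E (k ᵥ* E.1) = k := by
  have : E.1 * (E⁻¹).1 = 1 := by
    rw [← Matrix.SpecialLinearGroup.coe_mul, mul_inv_cancel, Matrix.SpecialLinearGroup.coe_one]
  rw [exponent, Matrix.vecMul_vecMul, this, Matrix.vecMul_one]

lemma vecMul_exponent (m : Fin 2 → ℤ) : exponent E m ᵥ* E.1 = m := by
  have : (E⁻¹).1 * E.1 = 1 := by
    rw [← Matrix.SpecialLinearGroup.coe_mul, inv_mul_cancel, Matrix.SpecialLinearGroup.coe_one]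
  rw [exponent, Matrix.vecMul_vecMul, this, Matrix.vecMul_one]

/-- The exponents of the change of coordinates `z'_a = ∏ z_b ^ A_ab`. -/
def transMatrix : Matrix (Fin 2) (Fin 2) ℤ := E'.1 * (E⁻¹).1

lemma transMatrix_row (a : Fin 2) : transMatrix E E' a = exponent E (E'.1 a) := by
  ext b; simp [transMatrix, exponent, Matrix.mul_apply, Matrix.vecMul, dotProduct]

lemma exponent_trans (m : Fin 2 → ℤ) :
    exponent E m = exponent E' m ᵥ* transMatrix E E' := by
  rw [transMatrix, ← Matrix.vecMul_vecMul, vecMul_exponent, exponent]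

lemma transMatrix_mul : transMatrix E E' * transMatrix E' E = 1 := by
  rw [transMatrix, transMatrix, ← Matrix.SpecialLinearGroup.coe_mul,
    ← Matrix.SpecialLinearGroup.coe_mul, ← Matrix.SpecialLinearGroup.coe_mul]
  simp

lemma exponent_row (a : Fin 2) : exponent E (E.1 a) = Pi.single a 1 := by
  rw [← transMatrix_row, transMatrix, ← Matrix.SpecialLinearGroup.coe_mul, mul_inv_cancel,
    Matrix.SpecialLinearGroup.coe_one]
  ext b; simp [Matrix.one_apply, Pi.single_apply, eq_comm]

lemma charValue_row (z : Fin 2 → ℂ) (a : Fin 2) : charValue E z (E.1 a) = some (z a) := by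
  rw [charValue, if_pos]
  · rw [exponent_row]; congr 1
    rw [Finset.prod_eq_single a] <;> simp +contextual
  · intro b _; rw [exponent_row]; by_cases h : b = a <;> simp [h]

/-- The change of coordinates between two patches. -/
def transMap (z : Fin 2 → ℂ) : Fin 2 → ℂ := fun a => ∏ b, z b ^ transMatrix E E' a b

variable {E E'}

lemma regular_iff {z z' : Fin 2 → ℂ} (h : charValue E z = charValue E' z') (k : Fin 2 → ℤ) :
    (∀ a, z' a = 0 → 0 ≤ k a) ↔ ∀ b, z b = 0 → 0 ≤ (k ᵥ* transMatrix E E') b := by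
  have h1 := congrFun h (k ᵥ* E'.1)
  have h2 := exponent_trans E E' (k ᵥ* E'.1)
  rw [exponent_vecMul] at h2
  rw [charValue, charValue, exponent_vecMul, h2] at h1
  split_ifs at h1 with h3 h4 h4 <;> tauto

lemma trans_nonneg {z z' : Fin 2 → ℂ} (h : charValue E z = charValue E' z') (a b : Fin 2)
    (hb : z b = 0) : 0 ≤ transMatrix E E' a b := by
  have := (regular_iff h (Pi.single a 1)).1
    (fun c _ => by by_cases h : c = a <;> simp [h]) b hb
  simpa using this

lemma trans_eq_zero {z z' : Fin 2 → ℂ} (h : charValue E z = charValue E' z') (a b : Fin 2)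
    (hb : z b = 0) (ha : z' a ≠ 0) : transMatrix E E' a b = 0 := by
  have := (regular_iff h (-Pi.single a 1)).1
    (fun c hc => by
      by_cases h : c = a
      · exact absurd (h ▸ hc) ha
      · simp [h]) b hb
  have h2 := trans_nonneg h a b hb
  simp [Matrix.neg_vecMul] at this
  omega

/-- On the overlap, each vanishing coordinate occurs in exactly one of the new coordinates, with
exponent one. -/
lemma exists_column {z z' : Fin 2 → ℂ} (h : charValue E z = charValue E' z') (b : Fin 2)
    (hb : z b = 0) : ∃ a, ∀ a', transMatrix E E' a' b = if a' = a then 1 else 0 := by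
  have hsum : ∑ a, transMatrix E' E b a * transMatrix E E' a b = 1 := by
    have := congrFun (congrFun (transMatrix_mul E' E) b) b
    simpa [Matrix.mul_apply] using this
  have hterm : ∀ a, transMatrix E E' a b ≠ 0 → 0 ≤ transMatrix E' E b a := fun a ha => by
    refine trans_nonneg h.symm b a ?_
    by_contra h0
    exact ha (trans_eq_zero h a b hb h0)
  obtain ⟨a, ha⟩ : ∃ a, transMatrix E' E b a * transMatrix E E' a b ≠ 0 := by
    by_contra! h0
    simp [h0] at hsum
  have ha1 := right_ne_zero_of_mul ha
  have hz'a : z' a = 0 := by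
    by_contra h0
    exact ha1 (trans_eq_zero h a b hb h0)
  have hBpos : 0 < transMatrix E' E b a :=
    lt_of_le_of_ne (hterm a ha1) (left_ne_zero_of_mul ha).symm
  have hApos : 0 < transMatrix E E' a b :=
    lt_of_le_of_ne (trans_nonneg h a b hb) ha1.symm
  have hnn : ∀ a', 0 ≤ transMatrix E' E b a' * transMatrix E E' a' b := fun a' => by
    by_cases h0 : transMatrix E E' a' b = 0
    · simp [h0]
    · exact mul_nonneg (hterm a' h0) (trans_nonneg h a' b hb)
  have hle : transMatrix E' E b a * transMatrix E E' a b ≤ 1 := by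
    rw [← hsum]; exact Finset.single_le_sum (fun i _ => hnn i) (Finset.mem_univ a)
  have hA1 : transMatrix E E' a b = 1 := by nlinarith
  refine ⟨a, fun a' => ?_⟩
  by_cases haa : a' = a
  · simp [haa, hA1]
  rw [if_neg haa]
  have hzero : ∑ c, transMatrix E E' a' c * transMatrix E' E c a = 0 := by
    have := congrFun (congrFun (transMatrix_mul E E') a') a
    simpa [Matrix.mul_apply, Matrix.one_apply, haa] using this
  have hnn' : ∀ c, 0 ≤ transMatrix E E' a' c * transMatrix E' E c a := fun c => by
    by_cases hc : z c = 0
    · exact mul_nonneg (trans_nonneg h a' c hc) (trans_nonneg h.symm c a hz'a)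
    · simp [trans_eq_zero h.symm c a hz'a hc]
  have h3 := (Finset.sum_eq_zero_iff_of_nonneg (fun i _ => hnn' i)).1 hzero b (Finset.mem_univ b)
  rcases mul_eq_zero.1 h3 with h4 | h4
  · exact h4
  · omega

lemma transMap_eq {z z' : Fin 2 → ℂ} (h : charValue E z = charValue E' z') :
    z' = transMap E E' z := by
  ext a
  have h1 := congrFun h (E'.1 a)
  rw [charValue_row, charValue, ← transMatrix_row] at h1
  split_ifs at h1 with h2
  simpa [transMap] using h1.symm

lemma charValue_transMap {z z' : Fin 2 → ℂ} (h : charValue E z = charValue E' z')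
    {w : Fin 2 → ℂ} (hw : ∀ b, z b ≠ 0 → w b ≠ 0) :
    charValue E w = charValue E' (transMap E E' w) := by
  have hz : ∀ b, w b = 0 → z b = 0 := fun b hb => by
    by_contra h0; exact hw b h0 hb
  have hex : ∀ b, w b = 0 → ∃ a, ∀ a', transMatrix E E' a' b = if a' = a then 1 else 0 :=
    fun b hb => exists_column h b (hz b hb)
  -- the vanishing coordinates correspond to each other
  have hzero : ∀ a, transMap E E' w a = 0 ↔ ∃ b, w b = 0 ∧ transMatrix E E' a b ≠ 0 := by
    intro a
    simp only [transMap, Finset.prod_eq_zero_iff, Finset.mem_univ, true_and]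
    refine exists_congr fun b => ?_
    constructor
    · intro h0
      refine ⟨?_, fun h1 => by simp [h1] at h0⟩
      by_contra h1
      exact zpow_ne_zero _ h1 h0
    · rintro ⟨h0, h1⟩
      rw [h0, zero_zpow _ h1]
  funext m
  have hexp := exponent_trans E E' m
  set k' := exponent E' m with hk'
  have hk : ∀ b, exponent E m b = ∑ a, k' a * transMatrix E E' a b := fun b => by
    rw [hexp]; rfl
  have hreg : (∀ b, w b = 0 → 0 ≤ exponent E m b) ↔
      ∀ a, transMap E E' w a = 0 → 0 ≤ k' a := by
    constructor
    · intro h1 a ha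
      obtain ⟨b, hb, hab⟩ := (hzero a).1 ha
      obtain ⟨a₀, ha₀⟩ := hex b hb
      have := h1 b hb
      rw [hk] at this
      simp only [ha₀, mul_ite, mul_one, mul_zero, Finset.sum_ite_eq', Finset.mem_univ,
        if_true] at this
      rw [ha₀] at hab
      have : a = a₀ := by by_contra h5; simp [h5] at hab
      subst this; assumption
    · intro h1 b hb
      obtain ⟨a₀, ha₀⟩ := hex b hb
      rw [hk]
      simp only [ha₀, mul_ite, mul_one, mul_zero, Finset.sum_ite_eq', Finset.mem_univ, if_true]
      exact h1 a₀ ((hzero a₀).2 ⟨b, hb, by simp [ha₀]⟩)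
  have hval : ∏ b, w b ^ exponent E m b = ∏ a, transMap E E' w a ^ k' a := by
    have h1 : ∀ a, transMap E E' w a ^ k' a = ∏ b, w b ^ (k' a * transMatrix E E' a b) := by
      intro a
      simp only [transMap]
      rw [← Finset.prod_zpow]
      exact Finset.prod_congr rfl fun b _ => by rw [← zpow_mul, mul_comm]
    simp_rw [h1]
    rw [Finset.prod_comm]
    refine Finset.prod_congr rfl fun b _ => ?_
    rw [hk]
    by_cases hb : w b = 0
    · obtain ⟨a₀, ha₀⟩ := hex b hb
      simp only [ha₀, mul_ite, mul_one, mul_zero, Finset.sum_ite_eq', Finset.mem_univ, if_true]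
      rw [Finset.prod_eq_single a₀] <;> simp +contextual
    · simp [Fin.sum_univ_two, Fin.prod_univ_two, zpow_add₀ hb]
  simp only [charValue, ← hk', hval]
  by_cases h5 : ∀ b, w b = 0 → 0 ≤ exponent E m b
  · rw [if_pos h5, if_pos (hreg.1 h5)]
  · rw [if_neg h5, if_neg (fun h6 => h5 (hreg.2 h6))]

variable (E E')

/-- The part of the patch of `E` that lies in the patch of `E'`. -/
def overlap : Set (Fin 2 → ℂ) := {z | ∃ z', charValue E z = charValue E' z'}

lemma isOpen_overlap : IsOpen (overlap E E') := by
  rw [isOpen_iff_mem_nhds]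
  rintro z ⟨z', h⟩
  have : ∀ᶠ w : Fin 2 → ℂ in nhds z, ∀ b, z b ≠ 0 → w b ≠ 0 := by
    rw [Filter.eventually_all]
    intro b
    by_cases hb : z b = 0
    · simp [hb]
    · have := (continuous_apply b).continuousAt.eventually_ne (x := z) hb
      filter_upwards [this] with w hw _ using hw
  filter_upwards [this] with w hw
  exact ⟨_, charValue_transMap h hw⟩

lemma contDiffOn_transMap : ContDiffOn ℂ ω (transMap E E') (overlap E E') := by
  rintro z ⟨z', h⟩
  refine ContDiffAt.contDiffWithinAt ?_
  rw [contDiffAt_pi]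
  intro a
  refine contDiffAt_prod fun b _ => ?_
  have hb : AnalyticAt ℂ (fun w : Fin 2 → ℂ => w b) z :=
    (ContinuousLinearMap.proj (R := ℂ) (φ := fun _ : Fin 2 => ℂ) b).analyticAt z
  by_cases hz : z b = 0
  · exact (hb.zpow_nonneg (trans_nonneg h a b hz)).contDiffAt
  · exact (hb.zpow hz).contDiffAt

end gluing

variable {Δ : Set (Fin 2 → ℝ)}

/-- The point with coordinates `z` in the patch of the corner `c`. -/
def Corner.point (c : Corner Δ) (z : Fin 2 → ℂ) : ToricSurface Δ :=
  ⟨charValue c.frame z, c, z, rfl⟩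

/-- The patch of a corner, with its coordinates `(z₁, z₂)`. -/
def Corner.patch (c : Corner Δ) : PartialEquiv (ToricSurface Δ) (Fin 2 → ℂ) where
  toFun x := fun a => (x.1 (c.frame.1 a)).getD 0
  invFun := c.point
  source := range c.point
  target := univ
  map_source' _ _ := mem_univ _
  map_target' z _ := mem_range_self z
  left_inv' := by
    rintro _ ⟨z, rfl⟩
    congr 1
    ext a
    simp [Corner.point, charValue_row]
  right_inv' z _ := by
    ext a
    simp [Corner.point, charValue_row]

lemma patch_source (c c' : Corner Δ) :
    (c.patch.symm.trans c'.patch).source = overlap c.frame c'.frame := by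
  ext z
  simp only [PartialEquiv.trans_source, PartialEquiv.symm_source, mem_inter_iff, mem_preimage]
  constructor
  · rintro ⟨-, z', hz'⟩
    exact ⟨z', (congrArg Subtype.val hz').symm⟩
  · rintro ⟨z', hz'⟩
    exact ⟨mem_univ _, z', Subtype.ext hz'.symm⟩

lemma patch_trans (c c' : Corner Δ) :
    EqOn (c.patch.symm.trans c'.patch) (transMap c.frame c'.frame)
      (overlap c.frame c'.frame) := by
  rintro z ⟨z', hz'⟩
  rw [← transMap_eq hz']
  have : c.point z = c'.point z' := Subtype.ext hz'
  change c'.patch (c.point z) = z'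
  rw [this]
  exact c'.patch.right_inv (mem_univ z')

variable (Δ) in
/-- The patches of the corners are an atlas. -/
def toricCore : ChartedSpaceCore (Fin 2 → ℂ) (ToricSurface Δ) where
  atlas := range Corner.patch
  chartAt x := x.2.choose.patch
  mem_chart_source x := by
    obtain ⟨z, hz⟩ := x.2.choose_spec
    exact ⟨z, Subtype.ext hz.symm⟩
  chart_mem_atlas x := mem_range_self _
  open_source := by
    rintro _ _ ⟨c, rfl⟩ ⟨c', rfl⟩
    rw [patch_source]
    exact isOpen_overlap _ _
  continuousOn_toFun := by
    rintro _ _ ⟨c, rfl⟩ ⟨c', rfl⟩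
    rw [patch_source]
    exact (contDiffOn_transMap _ _).continuousOn.congr (patch_trans c c')

instance : TopologicalSpace (ToricSurface Δ) := (toricCore Δ).toTopologicalSpace

instance : ChartedSpace (Fin 2 → ℂ) (ToricSurface Δ) := (toricCore Δ).toChartedSpace

/-- The coordinates `(z₁, z₂)` of the patch of a corner, as a chart. -/
def Corner.chart (c : Corner Δ) : OpenPartialHomeomorph (ToricSurface Δ) (Fin 2 → ℂ) :=
  (toricCore Δ).openPartialHomeomorph c.patch (mem_range_self c)

instance : IsManifold 𝓘(ℂ, Fin 2 → ℂ) ω (ToricSurface Δ) := by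
  refine isManifold_of_contDiffOn _ _ _ ?_
  intro e e' he he'
  simp only [atlas, ChartedSpace.atlas, mem_iUnion, mem_singleton_iff] at he he'
  obtain ⟨_, ⟨c, rfl⟩, rfl⟩ := he
  obtain ⟨_, ⟨c', rfl⟩, rfl⟩ := he'
  have hs := patch_source c c'
  have ht := patch_trans c c'
  have := (contDiffOn_transMap c.frame c'.frame).congr ht
  rw [← hs] at this
  simp only [modelWithCornersSelf_coe, modelWithCornersSelf_coe_symm, Function.comp_id,
    Function.id_comp, preimage_id, range_id, inter_univ]
  exact this

/-! ### Holomorphic Poisson structures and holomorphic symplectic groupoids -/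

section generic

variable {EM HM EX HX : Type*} [NormedAddCommGroup EM] [NormedSpace ℂ EM] [TopologicalSpace HM]
  [NormedAddCommGroup EX] [NormedSpace ℂ EX] [TopologicalSpace HX]
  (I : ModelWithCorners ℂ EM HM) (M : Type*) [TopologicalSpace M] [ChartedSpace HM M]
  (J : ModelWithCorners ℂ EX HX) (X : Type*) [TopologicalSpace X] [ChartedSpace HX X]

/-- Fields of complex bivectors of type `(2,0)`, as alternating bilinear forms on the holomorphic
cotangent spaces. -/
structure Bivector where
  toFun : ∀ x : M, (TangentSpace I x →L[ℂ] ℂ) →ₗ[ℂ] (TangentSpace I x →L[ℂ] ℂ) →ₗ[ℂ] ℂ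
  alt : ∀ x α, toFun x α α = 0

variable {I M} in
/-- The bracket `{f, g} = π(df, dg)` of complex functions. -/
def Bivector.bracket (π : Bivector I M) (f g : M → ℂ) (x : M) : ℂ :=
  π.toFun x (mfderiv I 𝓘(ℂ, ℂ) f x) (mfderiv I 𝓘(ℂ, ℂ) g x)

/-- Holomorphic Poisson structures: bivector fields for which the bracket of two local holomorphic
functions is holomorphic and satisfies the Jacobi identity. -/
structure HolPoisson extends Bivector I M where
  holomorphic : ∀ U : Set M, IsOpen U → ∀ f g : M → ℂ,
    ContMDiffOn I 𝓘(ℂ, ℂ) ω f U → ContMDiffOn I 𝓘(ℂ, ℂ) ω g U →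
      ContMDiffOn I 𝓘(ℂ, ℂ) ω (toBivector.bracket f g) U
  jacobi : ∀ U : Set M, IsOpen U → ∀ f g h : M → ℂ,
    ContMDiffOn I 𝓘(ℂ, ℂ) ω f U → ContMDiffOn I 𝓘(ℂ, ℂ) ω g U → ContMDiffOn I 𝓘(ℂ, ℂ) ω h U →
      ∀ x ∈ U, toBivector.bracket f (toBivector.bracket g h) x +
        toBivector.bracket g (toBivector.bracket h f) x +
        toBivector.bracket h (toBivector.bracket f g) x = 0

variable {J X} in
/-- The expression of a 2-form in the preferred chart at `x₀`. -/
def localForm (Ω : ∀ x : X, TangentSpace J x [⋀^Fin 2]→L[ℂ] ℂ) (x₀ : X) (y : EX) :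
    EX [⋀^Fin 2]→L[ℂ] ℂ :=
  (Ω ((extChartAt J x₀).symm y)).compContinuousLinearMap
    (mfderivWithin 𝓘(ℂ, EX) J (extChartAt J x₀).symm (range J) y)

/-- Holomorphic symplectic forms: closed, nondegenerate holomorphic 2-forms (of type `(2,0)`). -/
structure HolSymplecticForm where
  toFun : ∀ x : X, TangentSpace J x [⋀^Fin 2]→L[ℂ] ℂ
  holomorphic : ∀ x₀, ContDiffOn ℂ ω (localForm toFun x₀) (extChartAt J x₀).target
  closed : ∀ x₀, ∀ y ∈ (extChartAt J x₀).target,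
    extDerivWithin (localForm toFun x₀) (range J) y = 0
  nondegenerate : ∀ x v, (∀ w, toFun x ![v, w] = 0) → v = 0

variable {J X} in
/-- `P = Ω⁻¹`: if the covector `α` is `Ω(v, ·)`, then `P(α, ·) = v`. In a basis this says that the
matrices `(Ω(e_i, e_j))` and `(P(e^i, e^j))` are inverse to each other. -/
def IsInverse (P : Bivector J X) (Ω : HolSymplecticForm J X) : Prop :=
  ∀ (x : X) (v : TangentSpace J x) (α β : TangentSpace J x →L[ℂ] ℂ),
    (∀ w, α w = Ω.toFun x ![v, w]) → P.toFun x α β = β v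

/-- Holomorphic symplectic groupoids with space of objects `M` and space of arrows `X`. The product
`mul h g = h ∘ g` is only meaningful if `src h = tgt g`. -/
structure HolSymplecticGroupoid where
  src : X → M
  tgt : X → M
  unit : M → X
  inv : X → X
  mul : X → X → X
  -- groupoid axioms
  src_unit : ∀ m, src (unit m) = m
  tgt_unit : ∀ m, tgt (unit m) = m
  src_inv : ∀ g, src (inv g) = tgt g
  tgt_inv : ∀ g, tgt (inv g) = src g
  src_mul : ∀ h g, src h = tgt g → src (mul h g) = src g
  tgt_mul : ∀ h g, src h = tgt g → tgt (mul h g) = tgt h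
  mul_assoc : ∀ k h g, src k = tgt h → src h = tgt g → mul (mul k h) g = mul k (mul h g)
  mul_unit : ∀ g, mul g (unit (src g)) = g
  unit_mul : ∀ g, mul (unit (tgt g)) g = g
  mul_inv : ∀ g, mul g (inv g) = unit (tgt g)
  inv_mul : ∀ g, mul (inv g) g = unit (src g)
  -- all structure maps are holomorphic, source and target are submersions
  holomorphic_src : ContMDiff J I ω src
  holomorphic_tgt : ContMDiff J I ω tgt
  holomorphic_unit : ContMDiff I J ω unit
  holomorphic_inv : ContMDiff J J ω inv
  holomorphic_mul : ContMDiffOn (J.prod J) J ω (fun p : X × X => mul p.1 p.2)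
    {p | src p.1 = tgt p.2}
  submersion_src : ∀ g, Function.Surjective (mfderiv J I src g)
  submersion_tgt : ∀ g, Function.Surjective (mfderiv J I tgt g)
  -- the symplectic form
  form : HolSymplecticForm J X
  /-- `mul^* Ω = pr₁^* Ω + pr₂^* Ω` on the manifold of composable pairs, i.e. along every
  holomorphic family `(a u, b u)` of composable pairs. -/
  multiplicative : ∀ (k : ℕ) (U : Set (Fin k → ℂ)), IsOpen U → ∀ a b : (Fin k → ℂ) → X,
    ContMDiffOn 𝓘(ℂ, Fin k → ℂ) J ω a U → ContMDiffOn 𝓘(ℂ, Fin k → ℂ) J ω b U →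
    (∀ u ∈ U, src (a u) = tgt (b u)) → ∀ u ∈ U, ∀ e e' : Fin k → ℂ,
      form.toFun (mul (a u) (b u))
          ![mfderiv 𝓘(ℂ, Fin k → ℂ) J (fun y => mul (a y) (b y)) u e,
            mfderiv 𝓘(ℂ, Fin k → ℂ) J (fun y => mul (a y) (b y)) u e'] =
        form.toFun (a u)
          ![mfderiv 𝓘(ℂ, Fin k → ℂ) J a u e, mfderiv 𝓘(ℂ, Fin k → ℂ) J a u e'] +
        form.toFun (b u)
          ![mfderiv 𝓘(ℂ, Fin k → ℂ) J b u e, mfderiv 𝓘(ℂ, Fin k → ℂ) J b u e']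

variable {I M J X} in
/-- The groupoid integrates the holomorphic Poisson structure `σ`, where `P` is the inverse of its
symplectic form: the target is Poisson, the source is anti-Poisson, the fibres of source and target
are connected and simply connected, and the kernels of the differentials of source and target are
symplectic orthogonal complements of each other. -/
structure HolSymplecticGroupoid.Integrates (G : HolSymplecticGroupoid I M J X)
    (P : Bivector J X) (σ : HolPoisson I M) : Prop where
  inverse : IsInverse P G.form
  tgt_poisson : ∀ (g : X) (α β : TangentSpace I (G.tgt g) →L[ℂ] ℂ),
    P.toFun g (α.comp (mfderiv J I G.tgt g)) (β.comp (mfderiv J I G.tgt g)) =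
      σ.toFun (G.tgt g) α β
  src_antiPoisson : ∀ (g : X) (α β : TangentSpace I (G.src g) →L[ℂ] ℂ),
    P.toFun g (α.comp (mfderiv J I G.src g)) (β.comp (mfderiv J I G.src g)) =
      -σ.toFun (G.src g) α β
  simplyConnected_src : ∀ m, SimplyConnectedSpace (G.src ⁻¹' {m})
  simplyConnected_tgt : ∀ m, SimplyConnectedSpace (G.tgt ⁻¹' {m})
  orthogonal : ∀ (g : X) (v : TangentSpace J g), mfderiv J I G.tgt g v = 0 ↔
    ∀ w : TangentSpace J g, mfderiv J I G.src g w = 0 → G.form.toFun g ![v, w] = 0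

end generic

/-! ### The cotangent bundle of a toric surface -/

variable (Δ) in
/-- The holomorphic cotangent bundle of a toric surface. -/
abbrev ToricCotangent : Type :=
  Bundle.TotalSpace ((Fin 2 → ℂ) →L[ℂ] ℂ)
    (fun x : ToricSurface Δ => TangentSpace 𝓘(ℂ, Fin 2 → ℂ) x →L[ℂ] Bundle.Trivial _ ℂ x)

/-- The point of the cotangent bundle with local base coordinates `z` and fibre coordinates `ξ`,
i.e. the covector `ξ₁ dz₁ + ξ₂ dz₂` at the point `z` of the patch of the corner `c`. -/
def Corner.covector (c : Corner Δ) (p : (Fin 2 → ℂ) × (Fin 2 → ℂ)) : ToricCotangent Δ :=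
  ⟨c.chart.symm p.1, ∑ a, p.2 a •
    (ContinuousLinearMap.proj (R := ℂ) (φ := fun _ : Fin 2 => ℂ) a).comp (mfderiv 𝓘(ℂ, Fin 2 → ℂ)
      𝓘(ℂ, Fin 2 → ℂ) c.chart (c.chart.symm p.1))⟩

/-- `(p ∧ q)(v, w)` for linear forms `p`, `q`. -/
def wedge {V : Type*} (p q : V → ℂ) (v w : V) : ℂ := p v * q w - p w * q v

/-- The 1-form `dz_a` on `ℂ² × ℂ²`. -/
def dz (a : Fin 2) (v : (Fin 2 → ℂ) × (Fin 2 → ℂ)) : ℂ := v.1 a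

/-- The 1-form `dξ_a` on `ℂ² × ℂ²`. -/
def dξ (a : Fin 2) (v : (Fin 2 → ℂ) × (Fin 2 → ℂ)) : ℂ := v.2 a

/-- The model with corners of the cotangent bundle of a toric surface. -/
abbrev cotangentModel : ModelWithCorners ℂ ((Fin 2 → ℂ) × ((Fin 2 → ℂ) →L[ℂ] ℂ))
    (ModelProd (Fin 2 → ℂ) ((Fin 2 → ℂ) →L[ℂ] ℂ)) :=
  𝓘(ℂ, Fin 2 → ℂ).prod 𝓘(ℂ, (Fin 2 → ℂ) →L[ℂ] ℂ)

/-- The coordinate vector fields `∂/∂z_a` on the patch of a corner, as linear forms on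
covectors. -/
def Corner.baseVec (c : Corner Δ) (z : Fin 2 → ℂ) (a : Fin 2)
    (α : TangentSpace 𝓘(ℂ, Fin 2 → ℂ) (c.chart.symm z) →L[ℂ] ℂ) : ℂ :=
  α (mfderiv 𝓘(ℂ, Fin 2 → ℂ) 𝓘(ℂ, Fin 2 → ℂ) c.chart.symm z (Pi.single a 1 : Fin 2 → ℂ))

/-- The differential, at the point with coordinates `p = (z, ξ)`, of the parametrisation of the
cotangent bundle by local base and fibre coordinates. -/
def Corner.push (c : Corner Δ) (p : (Fin 2 → ℂ) × (Fin 2 → ℂ))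
    (v : (Fin 2 → ℂ) × (Fin 2 → ℂ)) : TangentSpace cotangentModel (c.covector p) :=
  mfderiv 𝓘(ℂ, (Fin 2 → ℂ) × (Fin 2 → ℂ)) cotangentModel c.covector p v

/-- The coordinate vector fields `∂/∂z_a` on the cotangent bundle, as linear forms on covectors. -/
def Corner.vecZ (c : Corner Δ) (p : (Fin 2 → ℂ) × (Fin 2 → ℂ)) (a : Fin 2)
    (α : TangentSpace cotangentModel (c.covector p) →L[ℂ] ℂ) : ℂ :=
  α (c.push p (Pi.single a 1, 0))

/-- The coordinate vector fields `∂/∂ξ_a` on the cotangent bundle, as linear forms on covectors. -/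
def Corner.vecξ (c : Corner Δ) (p : (Fin 2 → ℂ) × (Fin 2 → ℂ)) (a : Fin 2)
    (α : TangentSpace cotangentModel (c.covector p) →L[ℂ] ℂ) : ℂ :=
  α (c.push p (0, Pi.single a 1))

end ToricPoisson

end

open ToricPoisson Complex

/-!
The torus `(ℂˣ)²` acts on the toric surface `M`; let `V₁, V₂` be the fundamental vector fields of
the standard basis of its Lie algebra `ℂ²`. In the patch of a corner with frame `E` one has `V_i =
∑ E_ai z_a ∂/∂z_a`, and since `det E = 1`, the bivector field `σ = i V₁ ∧ V₂` is `i z₁ z₂ ∂/∂z₁ ∧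
∂/∂z₂` in every patch.

The cotangent lift of the action has a moment map `μ : T*M → ℂ²`, whose components are `μ_i = ∑
ξ_a z_a E_ai` in the patch (`moment`). All structure maps are expressed by the action and `μ`: an
arrow `g` over `x` has source `x` and target `exp (μ₂, -μ₁) · x`, and `h ∘ g` is the sum of `g`
and of the pullback of the covector `h` by the action of `exp (μ₂, -μ₁)`. This makes sense
globally, and in a patch it gives the stated formulas (`target_covector`, `compose_covector`),
since the torus acts diagonally there. Composable arrows always lie over a common patch
(`exists_composable`), so the groupoid axioms and the holomorphy of the structure maps reduce to
calculations with these formulas.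

The symplectic form is `-i` times the differential of `-(ξ₁ dz₁ + ξ₂ dz₂) - μ₁ dμ₂`. The
tautological 1-form and the moment map do not depend on the patch, so neither does this primitive
(`primitive_cotangentTrans`); its differential is closed, and equals `∑ dz_a ∧ dξ_a - dp₁ ∧ dp₂`
with `p_a = ξ_a z_a`, again because `det E = 1` (`extDeriv_primitive_apply`). Nondegeneracy, the
formula for the inverse, multiplicativity (`stdForm_localMul`), the Poisson property of source and
target and the orthogonality of the kernels of their differentials (`dtarget_eq_zero_iff`) are
then identities in the coordinates of a patch. The fibres of the source are the cotangent spaces,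
which are contractible, and the inversion exchanges them with the fibres of the target.
-/

noncomputable section

open Complex

namespace ToricPoisson

variable {Δ : Set (Fin 2 → ℝ)}

/-! ### The patches of the toric surface -/

theorem Corner.chart_target (c : Corner Δ) : c.chart.target = univ := rfl

theorem Corner.chart_symm_mem (c : Corner Δ) (z : Fin 2 → ℂ) : c.chart.symm z ∈ c.chart.source :=
  c.chart.map_target (mem_univ z)

theorem Corner.chart_chart_symm (c : Corner Δ) (z : Fin 2 → ℂ) : c.chart (c.chart.symm z) = z :=
  c.chart.right_inv (mem_univ z)

theorem Corner.chart_mem_atlas (c : Corner Δ) : c.chart ∈ atlas (Fin 2 → ℂ) (ToricSurface Δ) := by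
  simp only [atlas, ChartedSpace.atlas, mem_iUnion, mem_singleton_iff]
  exact ⟨_, ⟨c, rfl⟩, rfl⟩

theorem Corner.chart_mem_maximalAtlas (c : Corner Δ) :
    c.chart ∈ IsManifold.maximalAtlas 𝓘(ℂ, Fin 2 → ℂ) ω (ToricSurface Δ) :=
  IsManifold.subset_maximalAtlas c.chart_mem_atlas

theorem Corner.contMDiff_chart_symm (c : Corner Δ) :
    ContMDiff 𝓘(ℂ, Fin 2 → ℂ) 𝓘(ℂ, Fin 2 → ℂ) ω c.chart.symm :=
  contMDiffOn_univ.1 (contMDiffOn_symm_of_mem_maximalAtlas c.chart_mem_maximalAtlas)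

theorem Corner.contMDiffOn_chart (c : Corner Δ) :
    ContMDiffOn 𝓘(ℂ, Fin 2 → ℂ) 𝓘(ℂ, Fin 2 → ℂ) ω c.chart c.chart.source :=
  contMDiffOn_of_mem_maximalAtlas c.chart_mem_maximalAtlas

/-- The corner whose patch is the preferred chart at `x`. -/
def ToricSurface.corner (x : ToricSurface Δ) : Corner Δ := x.2.choose

theorem ToricSurface.chartAt_eq (x : ToricSurface Δ) :
    chartAt (Fin 2 → ℂ) x = x.corner.chart := rfl

theorem ToricSurface.mem_source (x : ToricSurface Δ) : x ∈ x.corner.chart.source :=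
  mem_chart_source (Fin 2 → ℂ) x

theorem Corner.mdiff_chart (c : Corner Δ) {x : ToricSurface Δ} (hx : x ∈ c.chart.source) :
    MDifferentiableAt 𝓘(ℂ, Fin 2 → ℂ) 𝓘(ℂ, Fin 2 → ℂ) c.chart x :=
  mdifferentiableAt_atlas c.chart_mem_atlas hx

theorem Corner.mdiff_chart_symm (c : Corner Δ) (z : Fin 2 → ℂ) :
    MDifferentiableAt 𝓘(ℂ, Fin 2 → ℂ) 𝓘(ℂ, Fin 2 → ℂ) c.chart.symm z :=
  c.contMDiff_chart_symm.mdifferentiable (by simp) z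

/-- The differential of the chart of a corner. All tangent spaces of the surface are by definition
the model space `ℂ²`; here and below they are written as such. -/
def Corner.dchart (c : Corner Δ) (x : ToricSurface Δ) : (Fin 2 → ℂ) →L[ℂ] (Fin 2 → ℂ) :=
  mfderiv 𝓘(ℂ, Fin 2 → ℂ) 𝓘(ℂ, Fin 2 → ℂ) c.chart x

/-- The differential of the parametrisation of the patch of a corner by its coordinates. -/
def Corner.dsymm (c : Corner Δ) (z : Fin 2 → ℂ) : (Fin 2 → ℂ) →L[ℂ] (Fin 2 → ℂ) :=
  mfderiv 𝓘(ℂ, Fin 2 → ℂ) 𝓘(ℂ, Fin 2 → ℂ) c.chart.symm z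

theorem Corner.dsymm_dchart (c : Corner Δ) {x : ToricSurface Δ} (hx : x ∈ c.chart.source)
    (v : Fin 2 → ℂ) : c.dsymm (c.chart x) (c.dchart x v) = v :=
  congrArg (fun f : (Fin 2 → ℂ) →L[ℂ] (Fin 2 → ℂ) => f v)
    ((mdifferentiable_of_mem_atlas (I := 𝓘(ℂ, Fin 2 → ℂ)) c.chart_mem_atlas).symm_comp_deriv hx)

theorem Corner.dchart_dsymm (c : Corner Δ) (z v : Fin 2 → ℂ) :
    c.dchart (c.chart.symm z) (c.dsymm z v) = v :=
  congrArg (fun f : (Fin 2 → ℂ) →L[ℂ] (Fin 2 → ℂ) => f v)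
    ((mdifferentiable_of_mem_atlas (I := 𝓘(ℂ, Fin 2 → ℂ)) c.chart_mem_atlas).comp_symm_deriv
      (mem_univ z))

/-! ### Coordinates on the cotangent bundle -/

/-- A point of the cotangent bundle as a linear form on the model space `ℂ²`. -/
def ToricCotangent.form (X : ToricCotangent Δ) : (Fin 2 → ℂ) →L[ℂ] ℂ := X.2

/-- The point of the cotangent bundle over `x` given by a linear form on the model space `ℂ²`. -/
def ToricCotangent.mk (x : ToricSurface Δ) (α : (Fin 2 → ℂ) →L[ℂ] ℂ) : ToricCotangent Δ := ⟨x, α⟩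

theorem ToricCotangent.ext' {X Y : ToricCotangent Δ} (h : X.1 = Y.1) (h' : X.form = Y.form) :
    X = Y := by
  obtain ⟨x, α⟩ := X
  obtain ⟨y, β⟩ := Y
  obtain rfl : x = y := h
  exact congrArg (Bundle.TotalSpace.mk x) h'

/-- The linear form `v ↦ ∑ ξ_a v_a`, depending linearly on `ξ`. -/
def linForm : (Fin 2 → ℂ) →L[ℂ] (Fin 2 → ℂ) →L[ℂ] ℂ :=
  ∑ a, ((ContinuousLinearMap.proj (R := ℂ) (φ := fun _ : Fin 2 => ℂ) a).smulRight
    (ContinuousLinearMap.proj (R := ℂ) (φ := fun _ : Fin 2 => ℂ) a))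

theorem linForm_apply (ξ v : Fin 2 → ℂ) : linForm ξ v = ∑ a, ξ a * v a := by
  simp [linForm]

theorem linForm_single (α : (Fin 2 → ℂ) →L[ℂ] ℂ) :
    linForm (fun a => α (Pi.single a 1)) = α := by
  ext v
  have hv : v = ∑ a, v a • (Pi.single a 1 : Fin 2 → ℂ) := by
    ext b; simp [Pi.single_apply, Finset.sum_apply, -Fin.sum_univ_two]
  conv_rhs => rw [hv]
  rw [linForm_apply, map_sum]
  simp only [map_smul, smul_eq_mul, mul_comm]

/-- The local base and fibre coordinates `(z, ξ)` on the cotangent bundle over the patch of a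
corner. -/
def Corner.coords (c : Corner Δ) (X : ToricCotangent Δ) : (Fin 2 → ℂ) × (Fin 2 → ℂ) :=
  (c.chart X.1, fun a => X.form (c.dsymm (c.chart X.1) (Pi.single a 1)))

theorem Corner.covector_fst (c : Corner Δ) (p : (Fin 2 → ℂ) × (Fin 2 → ℂ)) :
    (c.covector p).1 = c.chart.symm p.1 := rfl

theorem Corner.form_covector (c : Corner Δ) (p : (Fin 2 → ℂ) × (Fin 2 → ℂ)) :
    (c.covector p).form = (linForm p.2).comp (c.dchart (c.chart.symm p.1)) := by
  ext v
  simp only [linForm, ContinuousLinearMap.comp_apply, ToricCotangent.form, Corner.covector]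
  simp
  rfl

theorem Corner.form_covector_dsymm (c : Corner Δ) (p : (Fin 2 → ℂ) × (Fin 2 → ℂ))
    (v : Fin 2 → ℂ) : (c.covector p).form (c.dsymm p.1 v) = ∑ a, p.2 a * v a := by
  rw [c.form_covector, ContinuousLinearMap.comp_apply, c.dchart_dsymm, linForm_apply]

theorem Corner.coords_covector (c : Corner Δ) (p : (Fin 2 → ℂ) × (Fin 2 → ℂ)) :
    c.coords (c.covector p) = p := by
  refine Prod.ext (c.chart_chart_symm p.1) ?_
  ext a
  simp only [Corner.coords, c.covector_fst, c.chart_chart_symm, c.form_covector_dsymm]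
  simp [Pi.single_apply, -Fin.sum_univ_two]

theorem Corner.covector_coords (c : Corner Δ) {X : ToricCotangent Δ}
    (hX : X.1 ∈ c.chart.source) : c.covector (c.coords X) = X := by
  refine ToricCotangent.ext' (c.chart.left_inv hX) ?_
  rw [c.form_covector]
  ext v
  have h := linForm_single (X.form.comp (c.dsymm (c.chart X.1)))
  simp only [ContinuousLinearMap.comp_apply] at h
  simp only [Corner.coords, h, ContinuousLinearMap.comp_apply, c.chart.left_inv hX,
    c.dsymm_dchart hX]

theorem ToricCotangent.exists_covector (X : ToricCotangent Δ) :
    ∃ (c : Corner Δ) (p : (Fin 2 → ℂ) × (Fin 2 → ℂ)), X = c.covector p :=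
  ⟨X.1.corner, _, (X.1.corner.covector_coords X.1.mem_source).symm⟩

/-! ### The cotangent coordinates are holomorphic -/

theorem ToricSurface.extChartAt_eq (x : ToricSurface Δ) :
    (extChartAt 𝓘(ℂ, Fin 2 → ℂ) x : ToricSurface Δ → Fin 2 → ℂ) = x.corner.chart := by
  ext1 y; simp [ToricSurface.chartAt_eq]

theorem extChartAt_symm_eq (x : ToricSurface Δ) :
    ((extChartAt 𝓘(ℂ, Fin 2 → ℂ) x).symm : (Fin 2 → ℂ) → ToricSurface Δ) =
      x.corner.chart.symm := by
  ext1 y; simp [ToricSurface.chartAt_eq]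

/-- The preferred chart of the cotangent bundle at `X₀` consists of the coordinates of a patch and
of the components of covectors in the frame of the coordinate vector fields. -/
theorem extChartAt_apply (X₀ X : ToricCotangent Δ) (hX : X.1 ∈ X₀.1.corner.chart.source) :
    extChartAt cotangentModel X₀ X = (X₀.1.corner.chart X.1,
      X.form.comp (X₀.1.corner.dsymm (X₀.1.corner.chart X.1))) := by
  have h1 : extChartAt cotangentModel X₀ X = chartAt (ModelProd (Fin 2 → ℂ)
    ((Fin 2 → ℂ) →L[ℂ] ℂ)) X₀ X := by simp only [mfld_simps]
  rw [h1, hom_chart]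
  refine Prod.ext rfl ?_
  simp only
  rw [ContinuousLinearMap.inCoordinates, TangentBundle.symmL_trivializationAt hX]
  rw [ToricSurface.extChartAt_eq, extChartAt_symm_eq]
  ext v
  simp only [ContinuousLinearMap.comp_apply, mfld_simps, mfderivWithin_univ]
  simp [ToricCotangent.form, Corner.dsymm]
  rfl

theorem ToricCotangent.extChartAt_source (X₀ : ToricCotangent Δ) :
    (extChartAt cotangentModel X₀).source = {X | X.1 ∈ X₀.1.corner.chart.source} := by
  rw [_root_.extChartAt_source, FiberBundle.chartedSpace_chartAt]
  ext X
  simp only [mfld_simps, hom_trivializationAt_source]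
  simp [ToricSurface.chartAt_eq]
  exact fun h => h

theorem ToricCotangent.extChartAt_target (X₀ : ToricCotangent Δ) :
    (extChartAt cotangentModel X₀).target = univ := by
  rw [FiberBundle.extChartAt_target, hom_trivializationAt_baseSet]
  ext X
  simp [ToricSurface.chartAt_eq, Corner.chart_target, Corner.chart_symm_mem]

/-- The coordinates of a linear form, as an isomorphism. -/
def linFormEquiv : (Fin 2 → ℂ) ≃L[ℂ] ((Fin 2 → ℂ) →L[ℂ] ℂ) :=
  ContinuousLinearEquiv.equivOfInverse linForm
    (ContinuousLinearMap.pi fun a => ContinuousLinearMap.apply ℂ ℂ (Pi.single a 1 : Fin 2 → ℂ))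
    (fun ξ => by ext a; simp [linForm_apply, Pi.single_apply, -Fin.sum_univ_two])
    (fun α => linForm_single α)

/-- The coordinates `(z, ξ)` in terms of the preferred chart of the cotangent bundle. -/
def modelEquiv : ((Fin 2 → ℂ) × (Fin 2 → ℂ)) ≃L[ℂ] ((Fin 2 → ℂ) × ((Fin 2 → ℂ) →L[ℂ] ℂ)) :=
  (ContinuousLinearEquiv.refl ℂ _).prodCongr linFormEquiv

theorem modelEquiv_apply (p : (Fin 2 → ℂ) × (Fin 2 → ℂ)) :
    modelEquiv p = (p.1, linForm p.2) := rfl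

theorem extChartAt_covector (X₀ : ToricCotangent Δ) (p : (Fin 2 → ℂ) × (Fin 2 → ℂ)) :
    extChartAt cotangentModel X₀ (X₀.1.corner.covector p) = modelEquiv p := by
  rw [extChartAt_apply X₀ _ (Corner.chart_symm_mem _ _), modelEquiv_apply, Corner.form_covector,
    Corner.covector_fst, Corner.chart_chart_symm]
  congr 1
  ext v
  simp [Corner.dchart_dsymm]

theorem extChartAt_symm (X₀ : ToricCotangent Δ) (y : (Fin 2 → ℂ) × ((Fin 2 → ℂ) →L[ℂ] ℂ)) :
    (extChartAt cotangentModel X₀).symm y = X₀.1.corner.covector (modelEquiv.symm y) := by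
  apply (extChartAt cotangentModel X₀).injOn
  · exact (extChartAt cotangentModel X₀).map_target
      (by rw [ToricCotangent.extChartAt_target]; trivial)
  · rw [ToricCotangent.extChartAt_source]; exact Corner.chart_symm_mem _ _
  · rw [extChartAt_covector, ContinuousLinearEquiv.apply_symm_apply]
    exact (extChartAt cotangentModel X₀).right_inv
      (by rw [ToricCotangent.extChartAt_target]; trivial)

/-- The cotangent bundle over the patch of a corner. -/
def Corner.domain (c : Corner Δ) : Set (ToricCotangent Δ) := {X | X.1 ∈ c.chart.source}

theorem Corner.covector_mem (c : Corner Δ) (p : (Fin 2 → ℂ) × (Fin 2 → ℂ)) :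
    c.covector p ∈ c.domain := c.chart_symm_mem p.1

theorem Corner.isOpen_domain (c : Corner Δ) : IsOpen c.domain :=
  c.chart.open_source.preimage (FiberBundle.continuous_proj _ _)

theorem ToricSurface.contMDiff_covector_corner (x : ToricSurface Δ) :
    ContMDiff 𝓘(ℂ, (Fin 2 → ℂ) × (Fin 2 → ℂ)) cotangentModel ω x.corner.covector := by
  have h := contMDiffOn_extChartAt_symm (I := cotangentModel) (n := ω) (ToricCotangent.mk x 0)
  rw [ToricCotangent.extChartAt_target, contMDiffOn_univ] at h
  have h2 := h.comp modelEquiv.contDiff.contMDiff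
  have h3 : (extChartAt cotangentModel (ToricCotangent.mk x 0)).symm ∘ modelEquiv =
      x.corner.covector := by
    ext1 p
    rw [Function.comp_apply, extChartAt_symm, ContinuousLinearEquiv.symm_apply_apply]
    rfl
  rw [← h3]
  exact h2

theorem ToricSurface.contMDiffOn_coords_corner (x : ToricSurface Δ) :
    ContMDiffOn cotangentModel 𝓘(ℂ, (Fin 2 → ℂ) × (Fin 2 → ℂ)) ω x.corner.coords
      x.corner.domain := by
  have h := contMDiffOn_extChartAt (I := cotangentModel) (n := ω) (x := ToricCotangent.mk x 0)
  rw [← _root_.extChartAt_source cotangentModel, ToricCotangent.extChartAt_source] at h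
  have h2 := (modelEquiv.symm.contDiff.contMDiff (n := ω)).comp_contMDiffOn h
  refine h2.congr fun X hX => ?_
  rw [← x.corner.covector_coords hX, Corner.coords_covector]
  exact (modelEquiv.symm_apply_eq.2 (extChartAt_covector (ToricCotangent.mk x 0) _)).symm

/-! ### Changes of coordinates -/

theorem Corner.chart_symm_mem_iff {c c' : Corner Δ} {z : Fin 2 → ℂ} :
    c.chart.symm z ∈ c'.chart.source ↔ z ∈ overlap c.frame c'.frame := by
  constructor
  · rintro ⟨z', hz'⟩
    exact ⟨z', congrArg Subtype.val hz'.symm⟩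
  · rintro ⟨z', hz'⟩
    exact ⟨z', Subtype.ext hz'.symm⟩

theorem Corner.chart_chart_symm' {c c' : Corner Δ} {z : Fin 2 → ℂ}
    (hz : z ∈ overlap c.frame c'.frame) :
    c'.chart (c.chart.symm z) = transMap c.frame c'.frame z :=
  patch_trans c c' hz

theorem Corner.dchart_dsymm' {c c' : Corner Δ} {z : Fin 2 → ℂ}
    (hz : z ∈ overlap c.frame c'.frame) (v : Fin 2 → ℂ) :
    c'.dchart (c.chart.symm z) (c.dsymm z v) = fderiv ℂ (transMap c.frame c'.frame) z v := by
  have h1 := mfderiv_comp z (c'.mdiff_chart (c.chart_symm_mem_iff.2 hz)) (c.mdiff_chart_symm z)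
  have h2 : c'.chart ∘ c.chart.symm =ᶠ[nhds z] transMap c.frame c'.frame := by
    filter_upwards [(isOpen_overlap c.frame c'.frame).mem_nhds hz] with w hw
    exact Corner.chart_chart_symm' hw
  rw [← mfderiv_eq_fderiv, ← h2.mfderiv_eq, h1]
  rfl

/-- The change of the coordinates `(z, ξ)` on the cotangent bundle between two patches. -/
def cotangentTrans (E E' : Matrix.SpecialLinearGroup (Fin 2) ℤ)
    (p : (Fin 2 → ℂ) × (Fin 2 → ℂ)) : (Fin 2 → ℂ) × (Fin 2 → ℂ) :=
  (transMap E E' p.1, linFormEquiv.symm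
    ((linForm p.2).comp (fderiv ℂ (transMap E' E) (transMap E E' p.1))))

theorem transMap_mem_overlap {E E' : Matrix.SpecialLinearGroup (Fin 2) ℤ} {z : Fin 2 → ℂ}
    (hz : z ∈ overlap E E') : transMap E E' z ∈ overlap E' E := by
  obtain ⟨z', h⟩ := hz
  rw [← transMap_eq h]
  exact ⟨z, h.symm⟩

theorem transMap_transMap {E E' : Matrix.SpecialLinearGroup (Fin 2) ℤ} {z : Fin 2 → ℂ}
    (hz : z ∈ overlap E E') : transMap E' E (transMap E E' z) = z := by
  obtain ⟨z', h⟩ := hz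
  rw [← transMap_eq h, ← transMap_eq h.symm]

theorem Corner.chart_symm_eq {c c' : Corner Δ} {z : Fin 2 → ℂ}
    (hz : z ∈ overlap c.frame c'.frame) :
    c.chart.symm z = c'.chart.symm (transMap c.frame c'.frame z) := by
  rw [← Corner.chart_chart_symm' hz, c'.chart.left_inv (Corner.chart_symm_mem_iff.2 hz)]

/-- Covectors transform by the transposed inverse of the differential of the change of
coordinates. -/
theorem Corner.coords_covector' {c c' : Corner Δ} {p : (Fin 2 → ℂ) × (Fin 2 → ℂ)}
    (hp : p.1 ∈ overlap c.frame c'.frame) :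
    c'.coords (c.covector p) = cotangentTrans c.frame c'.frame p := by
  refine Prod.ext (Corner.chart_chart_symm' hp) ?_
  ext a
  simp only [Corner.coords, c.covector_fst, Corner.chart_chart_symm' hp, cotangentTrans]
  change _ = ((linForm p.2).comp _) _
  rw [ContinuousLinearMap.comp_apply, ← Corner.dchart_dsymm' (transMap_mem_overlap hp),
    ← Corner.chart_symm_eq hp, Corner.form_covector]
  rfl

theorem isOpen_overlap_prod (E E' : Matrix.SpecialLinearGroup (Fin 2) ℤ) :
    IsOpen {p : (Fin 2 → ℂ) × (Fin 2 → ℂ) | p.1 ∈ overlap E E'} :=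
  (isOpen_overlap E E').preimage continuous_fst

theorem contDiffOn_cotangentTrans (E E' : Matrix.SpecialLinearGroup (Fin 2) ℤ) :
    ContDiffOn ℂ ω (cotangentTrans E E') {p | p.1 ∈ overlap E E'} := by
  have h1 : ContDiffOn ℂ ω (fun p : (Fin 2 → ℂ) × (Fin 2 → ℂ) => transMap E E' p.1)
      {p | p.1 ∈ overlap E E'} :=
    (contDiffOn_transMap E E').comp contDiff_fst.contDiffOn fun p hp => hp
  have h2 : ContDiffOn ℂ ω (fun p : (Fin 2 → ℂ) × (Fin 2 → ℂ) =>
      fderiv ℂ (transMap E' E) (transMap E E' p.1)) {p | p.1 ∈ overlap E E'} :=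
    ((contDiffOn_transMap E' E).fderiv_of_isOpen (isOpen_overlap E' E) le_rfl).comp h1
      fun p hp => transMap_mem_overlap hp
  refine h1.prodMk (linFormEquiv.symm.contDiff.comp_contDiffOn ?_)
  exact (linForm.contDiff.comp contDiff_snd).contDiffOn.clm_comp h2

/-- The patch of `c` need not be the preferred chart at any of its points, so `c.covector` is
compared with the parametrisation that belongs to the preferred chart at the point in question. -/
theorem Corner.contMDiff_covector (c : Corner Δ) :
    ContMDiff 𝓘(ℂ, (Fin 2 → ℂ) × (Fin 2 → ℂ)) cotangentModel ω c.covector := by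
  intro p
  set x := c.chart.symm p.1 with hx
  have hp : p.1 ∈ overlap c.frame x.corner.frame :=
    Corner.chart_symm_mem_iff.1 x.mem_source
  have hU : {p : (Fin 2 → ℂ) × (Fin 2 → ℂ) | p.1 ∈ overlap c.frame x.corner.frame} ∈ nhds p :=
    (isOpen_overlap_prod c.frame x.corner.frame).mem_nhds hp
  have h1 : ContMDiffAt 𝓘(ℂ, (Fin 2 → ℂ) × (Fin 2 → ℂ)) 𝓘(ℂ, (Fin 2 → ℂ) × (Fin 2 → ℂ)) ω
      (cotangentTrans c.frame x.corner.frame) p :=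
    ((contDiffOn_cotangentTrans c.frame x.corner.frame).contDiffAt hU).contMDiffAt
  refine (x.contMDiff_covector_corner.contMDiffAt.comp p h1).congr_of_eventuallyEq ?_
  filter_upwards [hU] with q hq
  rw [Function.comp_apply, ← Corner.coords_covector' hq]
  exact (x.corner.covector_coords (Corner.chart_symm_mem_iff.2 hq)).symm

theorem Corner.contMDiffOn_coords (c : Corner Δ) :
    ContMDiffOn cotangentModel 𝓘(ℂ, (Fin 2 → ℂ) × (Fin 2 → ℂ)) ω c.coords c.domain := by
  intro X hX
  refine ContMDiffAt.contMDiffWithinAt ?_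
  set x := X.1 with hx
  have h1 : ContMDiffAt cotangentModel 𝓘(ℂ, (Fin 2 → ℂ) × (Fin 2 → ℂ)) ω x.corner.coords X :=
    x.contMDiffOn_coords_corner.contMDiffAt (x.corner.isOpen_domain.mem_nhds x.mem_source)
  have hX' : x.corner.covector (x.corner.coords X) = X := x.corner.covector_coords x.mem_source
  have hp : (x.corner.coords X).1 ∈ overlap x.corner.frame c.frame := by
    rw [← Corner.chart_symm_mem_iff, ← Corner.covector_fst, hX']; exact hX
  have h2 : ContMDiffAt 𝓘(ℂ, (Fin 2 → ℂ) × (Fin 2 → ℂ)) 𝓘(ℂ, (Fin 2 → ℂ) × (Fin 2 → ℂ)) ω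
      (cotangentTrans x.corner.frame c.frame) (x.corner.coords X) :=
    ((contDiffOn_cotangentTrans x.corner.frame c.frame).contDiffAt
      ((isOpen_overlap_prod _ _).mem_nhds hp)).contMDiffAt
  refine (h2.comp X h1).congr_of_eventuallyEq ?_
  filter_upwards [x.corner.isOpen_domain.mem_nhds x.mem_source, c.isOpen_domain.mem_nhds hX]
    with Y hY hY'
  have hY2 := x.corner.covector_coords hY
  rw [Function.comp_apply, ← Corner.coords_covector', hY2]
  rw [← Corner.chart_symm_mem_iff, ← Corner.covector_fst, hY2]
  exact hY'

/-! ### The symplectic form in coordinates -/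

theorem det_frame (E : Matrix.SpecialLinearGroup (Fin 2) ℤ) :
    (E.1 0 0 : ℂ) * E.1 1 1 - E.1 0 1 * E.1 1 0 = 1 := by
  have := E.2
  rw [Matrix.det_fin_two] at this
  exact_mod_cast this

/-- The moment map of the torus action on the cotangent bundle, in the coordinates of the patch with
frame `E`, and with values in the dual of the Lie algebra of the torus `(ℂˣ)²`. -/
def moment (E : Matrix.SpecialLinearGroup (Fin 2) ℤ) (q : (Fin 2 → ℂ) × (Fin 2 → ℂ)) :
    Fin 2 → ℂ :=
  fun i => ∑ a, q.2 a * q.1 a * (E.1 a i : ℂ)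

/-- The differential of the moment map; it is symmetric in the base point and the tangent vector. -/
def dmoment (E : Matrix.SpecialLinearGroup (Fin 2) ℤ) (q w : (Fin 2 → ℂ) × (Fin 2 → ℂ)) :
    Fin 2 → ℂ :=
  fun i => ∑ a, (q.2 a * w.1 a + w.2 a * q.1 a) * (E.1 a i : ℂ)

theorem contDiff_moment (E : Matrix.SpecialLinearGroup (Fin 2) ℤ) : ContDiff ℂ ω (moment E) := by
  unfold moment
  fun_prop

/-- The linear form `dz_a` on `ℂ² × ℂ²`, as a continuous linear map. -/
def dzL (a : Fin 2) : (Fin 2 → ℂ) × (Fin 2 → ℂ) →L[ℂ] ℂ :=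
  (ContinuousLinearMap.proj (R := ℂ) (φ := fun _ : Fin 2 => ℂ) a).comp
    (ContinuousLinearMap.fst ℂ (Fin 2 → ℂ) (Fin 2 → ℂ))

/-- The linear form `dξ_a` on `ℂ² × ℂ²`, as a continuous linear map. -/
def dξL (a : Fin 2) : (Fin 2 → ℂ) × (Fin 2 → ℂ) →L[ℂ] ℂ :=
  (ContinuousLinearMap.proj (R := ℂ) (φ := fun _ : Fin 2 => ℂ) a).comp
    (ContinuousLinearMap.snd ℂ (Fin 2 → ℂ) (Fin 2 → ℂ))

theorem dzL_apply (a : Fin 2) (v : (Fin 2 → ℂ) × (Fin 2 → ℂ)) : dzL a v = v.1 a := rfl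

theorem dξL_apply (a : Fin 2) (v : (Fin 2 → ℂ) × (Fin 2 → ℂ)) : dξL a v = v.2 a := rfl

theorem hasFDerivAt_fst_apply (a : Fin 2) (q : (Fin 2 → ℂ) × (Fin 2 → ℂ)) :
    HasFDerivAt (𝕜 := ℂ) (fun q : (Fin 2 → ℂ) × (Fin 2 → ℂ) => q.1 a) (dzL a) q :=
  (dzL a).hasFDerivAt

theorem hasFDerivAt_snd_apply (a : Fin 2) (q : (Fin 2 → ℂ) × (Fin 2 → ℂ)) :
    HasFDerivAt (𝕜 := ℂ) (fun q : (Fin 2 → ℂ) × (Fin 2 → ℂ) => q.2 a) (dξL a) q :=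
  (dξL a).hasFDerivAt

theorem fderiv_moment (E : Matrix.SpecialLinearGroup (Fin 2) ℤ)
    (q w : (Fin 2 → ℂ) × (Fin 2 → ℂ)) : fderiv ℂ (moment E) q w = dmoment E q w := by
  ext i
  have h3 : HasFDerivAt (fun q => moment E q i) _ q :=
    HasFDerivAt.fun_sum fun a _ =>
      ((hasFDerivAt_snd_apply a q).mul (hasFDerivAt_fst_apply a q)).mul_const (E.1 a i : ℂ)
  have h4 := fderiv_apply ((contDiff_moment E).differentiable (by simp) q) i
  rw [h3.fderiv] at h4
  have h5 := congrArg (fun f => f w) h4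
  refine Eq.trans h5.symm ?_
  simp [dmoment, dzL_apply, dξL_apply]
  ring

/-- The 1-form `-(ξ₁ dz₁ + ξ₂ dz₂) - μ₁ dμ₂`, where `μ` is the moment map. Both the tautological
1-form and the moment map are independent of the patch, hence so is this form. -/
def primitive (E : Matrix.SpecialLinearGroup (Fin 2) ℤ) (q : (Fin 2 → ℂ) × (Fin 2 → ℂ)) :
    ((Fin 2 → ℂ) × (Fin 2 → ℂ)) →L[ℂ] ℂ :=
  -(linForm q.2).comp (ContinuousLinearMap.fst ℂ (Fin 2 → ℂ) (Fin 2 → ℂ)) - moment E q 0 •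
    (ContinuousLinearMap.proj (R := ℂ) (φ := fun _ : Fin 2 => ℂ) 1).comp (fderiv ℂ (moment E) q)

theorem primitive_apply (E : Matrix.SpecialLinearGroup (Fin 2) ℤ)
    (q w : (Fin 2 → ℂ) × (Fin 2 → ℂ)) :
    primitive E q w = -(∑ a, q.2 a * w.1 a) - moment E q 0 * dmoment E q w 1 := by
  simp [primitive, linForm_apply, fderiv_moment]

theorem contDiff_primitive (E : Matrix.SpecialLinearGroup (Fin 2) ℤ) :
    ContDiff ℂ ω (primitive E) := by
  have h1 := contDiff_moment E
  have h2 : ContDiff ℂ ω (fderiv ℂ (moment E)) := h1.fderiv_right le_rfl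
  have h3 : ContDiff ℂ ω (fun q => moment E q 0) := contDiff_pi.1 h1 0
  have h4 : ContDiff ℂ ω (fun q : (Fin 2 → ℂ) × (Fin 2 → ℂ) =>
      (linForm q.2).comp (ContinuousLinearMap.fst ℂ (Fin 2 → ℂ) (Fin 2 → ℂ))) :=
    (linForm.contDiff.comp contDiff_snd).clm_comp contDiff_const
  exact h4.neg.sub (h3.smul (contDiff_const.clm_comp h2))

/-- A field of linear forms as a differential 1-form. -/
def oneForm {V : Type*} [NormedAddCommGroup V] [NormedSpace ℂ V] (θ : V → V →L[ℂ] ℂ) (x : V) :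
    V [⋀^Fin 1]→L[ℂ] ℂ :=
  ContinuousAlternatingMap.ofSubsingletonLIE (𝕜 := ℂ) (E := V) (F := ℂ) (0 : Fin 1) (θ x)

theorem contDiff_oneForm {V : Type*} [NormedAddCommGroup V] [NormedSpace ℂ V]
    {θ : V → V →L[ℂ] ℂ} (h : ContDiff ℂ ω θ) : ContDiff ℂ ω (oneForm θ) :=
  (ContinuousAlternatingMap.ofSubsingletonLIE (𝕜 := ℂ) (E := V) (F := ℂ)
    (0 : Fin 1)).toContinuousLinearEquiv.contDiff.comp h

theorem extDeriv_oneForm {V : Type*} [NormedAddCommGroup V] [NormedSpace ℂ V]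
    {θ : V → V →L[ℂ] ℂ} (h : ContDiff ℂ ω θ) (x v w : V) :
    extDeriv (oneForm θ) x ![v, w] =
      fderiv ℂ (fun y => θ y w) x v - fderiv ℂ (fun y => θ y v) x w := by
  rw [extDeriv_apply ((contDiff_oneForm h).differentiable (by simp) x)]
  simp [Fin.sum_univ_two, oneForm, Fin.removeNth, sub_eq_add_neg]

theorem fderiv_primitive (E : Matrix.SpecialLinearGroup (Fin 2) ℤ)
    (q v w : (Fin 2 → ℂ) × (Fin 2 → ℂ)) :
    fderiv ℂ (fun y => primitive E y w) q v = -(∑ a, v.2 a * w.1 a) -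
      (dmoment E q v 0 * dmoment E q w 1 + moment E q 0 * dmoment E v w 1) := by
  have h1 : HasFDerivAt (fun q => moment E q 0) _ q :=
    HasFDerivAt.fun_sum fun a _ =>
      ((hasFDerivAt_snd_apply a q).mul (hasFDerivAt_fst_apply a q)).mul_const (E.1 a 0 : ℂ)
  have h2 : HasFDerivAt (fun q => dmoment E q w 1) _ q :=
    HasFDerivAt.fun_sum fun a _ =>
      (((hasFDerivAt_snd_apply a q).mul_const (w.1 a)).add
        ((hasFDerivAt_fst_apply a q).const_mul (w.2 a))).mul_const (E.1 a 1 : ℂ)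
  have h3 : HasFDerivAt (fun q : (Fin 2 → ℂ) × (Fin 2 → ℂ) => ∑ a, q.2 a * w.1 a) _ q :=
    HasFDerivAt.fun_sum fun a _ => (hasFDerivAt_snd_apply a q).mul_const (w.1 a)
  simp only [primitive_apply]
  rw [(h3.fun_neg.fun_sub (h1.fun_mul h2)).fderiv]
  simp [dmoment, dzL_apply, dξL_apply, moment]
  ring

/-- The symplectic form of the groupoid in local coordinates. It is defined as an exact form, so
that its closedness and its behaviour under changes of coordinates follow from those of its
primitive. The choice of the frame in the primitive does not matter (`stdForm_eq`). -/
def stdForm (q : (Fin 2 → ℂ) × (Fin 2 → ℂ)) : ((Fin 2 → ℂ) × (Fin 2 → ℂ)) [⋀^Fin 2]→L[ℂ] ℂ :=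
  -I • extDeriv (oneForm (primitive 1)) q

/-- The exterior derivative of the primitive. In logarithmic coordinates `u_a = log z_a`, `p_a =
ξ_a z_a` this is `du₁ ∧ dp₁ + du₂ ∧ dp₂ - dp₁ ∧ dp₂`. -/
theorem extDeriv_primitive_apply (E : Matrix.SpecialLinearGroup (Fin 2) ℤ)
    (q v w : (Fin 2 → ℂ) × (Fin 2 → ℂ)) :
    extDeriv (oneForm (primitive E)) q ![v, w] =
      ∑ a, (v.1 a * w.2 a - v.2 a * w.1 a) -
      ((q.2 0 * v.1 0 + v.2 0 * q.1 0) * (q.2 1 * w.1 1 + w.2 1 * q.1 1) -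
        (q.2 1 * v.1 1 + v.2 1 * q.1 1) * (q.2 0 * w.1 0 + w.2 0 * q.1 0)) := by
  have hE := det_frame E
  rw [extDeriv_oneForm (contDiff_primitive E), fderiv_primitive, fderiv_primitive]
  simp only [dmoment, Fin.sum_univ_two]
  linear_combination (-((q.2 0 * v.1 0 + v.2 0 * q.1 0) * (q.2 1 * w.1 1 + w.2 1 * q.1 1) -
        (q.2 1 * v.1 1 + v.2 1 * q.1 1) * (q.2 0 * w.1 0 + w.2 0 * q.1 0))) * hE

/-! ### The torus action in coordinates -/

/-- The action of `exp s`, for `s` in the Lie algebra `ℂ²` of the torus, in the coordinates of the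
patch with frame `E`. -/
def expScale (E : Matrix.SpecialLinearGroup (Fin 2) ℤ) (s z : Fin 2 → ℂ) : Fin 2 → ℂ :=
  fun a => exp (∑ i, (E.1 a i : ℂ) * s i) * z a

theorem transMatrix_mul_frame (E E' : Matrix.SpecialLinearGroup (Fin 2) ℤ) :
    transMatrix E E' * E.1 = E'.1 := by
  rw [transMatrix, Matrix.mul_assoc, ← Matrix.SpecialLinearGroup.coe_mul]
  simp

theorem prod_exp_zpow (E : Matrix.SpecialLinearGroup (Fin 2) ℤ) (s : Fin 2 → ℂ) (k : Fin 2 → ℤ) :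
    ∏ b, exp (∑ i, (E.1 b i : ℂ) * s i) ^ k b = exp (∑ i, ((k ᵥ* E.1) i : ℂ) * s i) := by
  simp only [← exp_int_mul, ← exp_sum, Matrix.vecMul, dotProduct, Int.cast_sum, Int.cast_mul,
    Finset.mul_sum, Finset.sum_mul]
  rw [Finset.sum_comm]
  simp only [mul_assoc]

/-- Changes of coordinates are equivariant for the torus action. -/
theorem transMap_expScale (E E' : Matrix.SpecialLinearGroup (Fin 2) ℤ) (s z : Fin 2 → ℂ) :
    transMap E E' (expScale E s z) = expScale E' s (transMap E E' z) := by
  ext a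
  simp only [transMap, expScale, mul_zpow, Finset.prod_mul_distrib, prod_exp_zpow]
  congr 4
  ext i
  have := congrFun (congrFun (transMatrix_mul_frame E E') a) i
  rw [← this]
  rfl

theorem hasDerivAt_expScale (E : Matrix.SpecialLinearGroup (Fin 2) ℤ) (s z : Fin 2 → ℂ) :
    HasDerivAt (fun t : ℂ => expScale E (t • s) z)
      (fun a => (∑ i, (E.1 a i : ℂ) * s i) * z a) 0 := by
  rw [hasDerivAt_pi]
  intro a
  have h1 : HasDerivAt (fun t : ℂ => t * ∑ i, (E.1 a i : ℂ) * s i)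
      (∑ i, (E.1 a i : ℂ) * s i) 0 := by
    simpa using (hasDerivAt_id (0 : ℂ)).mul_const (∑ i, (E.1 a i : ℂ) * s i)
  have h2 := h1.cexp.mul_const (z a)
  simp only [zero_mul, exp_zero, one_mul] at h2
  refine h2.congr_of_eventuallyEq (Filter.Eventually.of_forall fun t => ?_)
  simp only [expScale, Finset.mul_sum, Pi.smul_apply, smul_eq_mul]
  congr 3
  ext i
  ring

theorem expScale_zero (E : Matrix.SpecialLinearGroup (Fin 2) ℤ) (z : Fin 2 → ℂ) :
    expScale E 0 z = z := by
  ext a; simp [expScale]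

theorem differentiableAt_transMap {E E' : Matrix.SpecialLinearGroup (Fin 2) ℤ} {z : Fin 2 → ℂ}
    (hz : z ∈ overlap E E') : DifferentiableAt ℂ (transMap E E') z :=
  ((contDiffOn_transMap E E').contDiffAt ((isOpen_overlap E E').mem_nhds hz)).differentiableAt
    (by simp)

/-- The fundamental vector fields of the torus action agree on overlaps. -/
theorem fderiv_transMap_fundamental {E E' : Matrix.SpecialLinearGroup (Fin 2) ℤ} {z : Fin 2 → ℂ}
    (hz : z ∈ overlap E E') (s : Fin 2 → ℂ) :
    fderiv ℂ (transMap E E') z (fun a => (∑ i, (E.1 a i : ℂ) * s i) * z a) =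
      fun a => (∑ i, (E'.1 a i : ℂ) * s i) * transMap E E' z a := by
  have h0 : expScale E ((0 : ℂ) • s) z = z := by rw [zero_smul, expScale_zero]
  have h1 : HasFDerivAt (transMap E E') (fderiv ℂ (transMap E E') z)
      (expScale E ((0 : ℂ) • s) z) := by
    rw [h0]; exact (differentiableAt_transMap hz).hasFDerivAt
  have h2 := h1.comp_hasDerivAt (0 : ℂ) (hasDerivAt_expScale E s z)
  have h3 := hasDerivAt_expScale E' s (transMap E E' z)
  refine h2.unique (h3.congr_of_eventuallyEq (Filter.Eventually.of_forall fun t => ?_))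
  exact transMap_expScale E E' (t • s) z

theorem fderiv_transMap_fderiv_transMap {E E' : Matrix.SpecialLinearGroup (Fin 2) ℤ}
    {z : Fin 2 → ℂ} (hz : z ∈ overlap E E') (v : Fin 2 → ℂ) :
    fderiv ℂ (transMap E' E) (transMap E E' z) (fderiv ℂ (transMap E E') z v) = v := by
  have h1 := (differentiableAt_transMap (transMap_mem_overlap hz)).hasFDerivAt.comp z
    (differentiableAt_transMap hz).hasFDerivAt
  have h2 : HasFDerivAt (transMap E' E ∘ transMap E E') (ContinuousLinearMap.id ℂ _) z := by
    refine (hasFDerivAt_id z).congr_of_eventuallyEq ?_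
    filter_upwards [(isOpen_overlap E E').mem_nhds hz] with w hw
    exact transMap_transMap hw
  exact congrArg (fun f => f v) (h1.unique h2)

/-! ### Independence of the patch -/

theorem linForm_linFormEquiv_symm (α : (Fin 2 → ℂ) →L[ℂ] ℂ) : linForm (linFormEquiv.symm α) = α :=
  linFormEquiv.apply_symm_apply α

theorem moment_eq_linForm (E : Matrix.SpecialLinearGroup (Fin 2) ℤ)
    (q : (Fin 2 → ℂ) × (Fin 2 → ℂ)) (i : Fin 2) :
    moment E q i = linForm q.2
      (fun a => (∑ j, (E.1 a j : ℂ) * (Pi.single i 1 : Fin 2 → ℂ) j) * q.1 a) := by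
  rw [linForm_apply]
  simp only [moment, Pi.single_apply, mul_ite, mul_one, mul_zero, Finset.sum_ite_eq',
    Finset.mem_univ, if_true]
  exact Finset.sum_congr rfl fun a _ => by ring

/-- The moment maps of the patches agree on overlaps, as they pair a covector with the fundamental
vector fields. -/
theorem moment_cotangentTrans {E E' : Matrix.SpecialLinearGroup (Fin 2) ℤ}
    {q : (Fin 2 → ℂ) × (Fin 2 → ℂ)} (hq : q.1 ∈ overlap E E') :
    moment E' (cotangentTrans E E' q) = moment E q := by
  ext i
  rw [moment_eq_linForm, moment_eq_linForm]
  simp only [cotangentTrans, linForm_linFormEquiv_symm, ContinuousLinearMap.comp_apply]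
  rw [fderiv_transMap_fundamental (transMap_mem_overlap hq), transMap_transMap hq]

theorem contDiffAt_cotangentTrans {E E' : Matrix.SpecialLinearGroup (Fin 2) ℤ}
    {q : (Fin 2 → ℂ) × (Fin 2 → ℂ)} (hq : q.1 ∈ overlap E E') :
    ContDiffAt ℂ ω (cotangentTrans E E') q :=
  (contDiffOn_cotangentTrans E E').contDiffAt ((isOpen_overlap_prod E E').mem_nhds hq)

theorem fderiv_cotangentTrans_fst {E E' : Matrix.SpecialLinearGroup (Fin 2) ℤ}
    {q : (Fin 2 → ℂ) × (Fin 2 → ℂ)} (hq : q.1 ∈ overlap E E') (v : (Fin 2 → ℂ) × (Fin 2 → ℂ)) :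
    (fderiv ℂ (cotangentTrans E E') q v).1 = fderiv ℂ (transMap E E') q.1 v.1 := by
  have h1 := hasFDerivAt_fst.comp q
    ((contDiffAt_cotangentTrans hq).differentiableAt (by simp)).hasFDerivAt
  have h2 := (differentiableAt_transMap hq).hasFDerivAt.comp q hasFDerivAt_fst
  exact congrArg (fun f => f v) (h1.unique h2)

/-- The primitives of the symplectic form agree on overlaps. -/
theorem primitive_cotangentTrans {E E' : Matrix.SpecialLinearGroup (Fin 2) ℤ}
    {q : (Fin 2 → ℂ) × (Fin 2 → ℂ)} (hq : q.1 ∈ overlap E E') :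
    (primitive E' (cotangentTrans E E' q)).comp (fderiv ℂ (cotangentTrans E E') q) =
      primitive E q := by
  refine ContinuousLinearMap.ext fun v => ?_
  have h1 : HasFDerivAt (moment E') (fderiv ℂ (moment E') (cotangentTrans E E' q))
      (cotangentTrans E E' q) :=
    ((contDiff_moment E').differentiable (by simp) _).hasFDerivAt
  have h2 := h1.comp q ((contDiffAt_cotangentTrans hq).differentiableAt (by simp)).hasFDerivAt
  have h3 : HasFDerivAt (moment E' ∘ cotangentTrans E E') (fderiv ℂ (moment E) q) q := by
    refine ((contDiff_moment E).differentiable (by simp) q).hasFDerivAt.congr_of_eventuallyEq ?_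
    filter_upwards [(isOpen_overlap_prod E E').mem_nhds hq] with p hp
    exact moment_cotangentTrans hp
  have h4 := congrArg (fun f => f v) (h2.unique h3)
  simp only [ContinuousLinearMap.comp_apply] at h4
  simp only [primitive, ContinuousLinearMap.comp_apply, sub_apply,
    neg_apply, smul_apply, h4, moment_cotangentTrans hq,
    ContinuousLinearMap.coe_fst', fderiv_cotangentTrans_fst hq]
  congr 2
  simp only [cotangentTrans, linForm_linFormEquiv_symm, ContinuousLinearMap.comp_apply,
    fderiv_transMap_fderiv_transMap hq]

theorem oneForm_compContinuousLinearMap {V W : Type*} [NormedAddCommGroup V] [NormedSpace ℂ V]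
    [NormedAddCommGroup W] [NormedSpace ℂ W] (θ : V → V →L[ℂ] ℂ) (θ' : W → W →L[ℂ] ℂ)
    (f : W →L[ℂ] V) (x : V) (y : W) (h : (θ x).comp f = θ' y) :
    (oneForm θ x).compContinuousLinearMap f = oneForm θ' y := by
  ext v
  simp [oneForm, ← h]

/-- All frames give the same symplectic form in coordinates, as they are unimodular. -/
theorem stdForm_eq (E : Matrix.SpecialLinearGroup (Fin 2) ℤ) :
    stdForm = fun q => -I • extDeriv (oneForm (primitive E)) q := by
  ext q v
  obtain ⟨v, w, rfl⟩ : ∃ x y, v = ![x, y] :=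
    ⟨v 0, v 1, funext fun i => by fin_cases i <;> rfl⟩
  simp only [stdForm, ContinuousAlternatingMap.smul_apply, extDeriv_primitive_apply]

/-- The symplectic forms of the patches agree on overlaps. -/
theorem stdForm_cotangentTrans {E E' : Matrix.SpecialLinearGroup (Fin 2) ℤ}
    {q : (Fin 2 → ℂ) × (Fin 2 → ℂ)} (hq : q.1 ∈ overlap E E') :
    (stdForm (cotangentTrans E E' q)).compContinuousLinearMap
      (fderiv ℂ (cotangentTrans E E') q) = stdForm q := by
  have h1 := extDeriv_pullback (𝕜 := ℂ)
    ((contDiff_oneForm (contDiff_primitive E')).differentiable (by simp) _)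
    (contDiffAt_cotangentTrans hq) le_top
  have h2 : (fun p => (oneForm (primitive E') (cotangentTrans E E' p)).compContinuousLinearMap
      (fderiv ℂ (cotangentTrans E E') p)) =ᶠ[nhds q] oneForm (primitive E) := by
    filter_upwards [(isOpen_overlap_prod E E').mem_nhds hq] with p hp
    exact oneForm_compContinuousLinearMap _ _ _ _ _ (primitive_cotangentTrans hp)
  rw [h2.extDeriv_eq] at h1
  have h3 : stdForm q = -I • extDeriv (oneForm (primitive E)) q := by rw [stdForm_eq E]
  rw [h3, h1, stdForm_eq E']
  rfl

theorem stdForm_apply (q v w : (Fin 2 → ℂ) × (Fin 2 → ℂ)) :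
    stdForm q ![v, w] = -I * (∑ a, (v.1 a * w.2 a - v.2 a * w.1 a) -
      ((q.2 0 * v.1 0 + v.2 0 * q.1 0) * (q.2 1 * w.1 1 + w.2 1 * q.1 1) -
        (q.2 1 * v.1 1 + v.2 1 * q.1 1) * (q.2 0 * w.1 0 + w.2 0 * q.1 0))) := by
  rw [stdForm, ContinuousAlternatingMap.smul_apply, extDeriv_primitive_apply, smul_eq_mul]

theorem contDiff_stdForm : ContDiff ℂ ω stdForm := by
  have h1 : ContDiff ℂ ω (fderiv ℂ (oneForm (primitive 1))) :=
    (contDiff_oneForm (contDiff_primitive 1)).fderiv_right le_rfl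
  have h2 := (ContinuousAlternatingMap.alternatizeUncurryFinCLM ℂ ((Fin 2 → ℂ) × (Fin 2 → ℂ)) ℂ
    (n := 1)).contDiff.comp h1
  exact h2.const_smul (-I)

theorem extDeriv_stdForm : extDeriv stdForm = 0 := by
  ext1 q
  have h1 := extDeriv_extDeriv (𝕜 := ℂ) (contDiff_oneForm (contDiff_primitive 1)) le_top
  change extDeriv (-I • extDeriv (oneForm (primitive 1))) q = 0
  rw [extDeriv_smul, h1]
  simp

/-! ### The symplectic form on the cotangent bundle -/

/-- `Corner.push` as a linear map into the model space, which by definition is the tangent space. -/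
def Corner.pushL (c : Corner Δ) (p : (Fin 2 → ℂ) × (Fin 2 → ℂ)) :
    ((Fin 2 → ℂ) × (Fin 2 → ℂ)) →L[ℂ] ((Fin 2 → ℂ) × ((Fin 2 → ℂ) →L[ℂ] ℂ)) :=
  mfderiv 𝓘(ℂ, (Fin 2 → ℂ) × (Fin 2 → ℂ)) cotangentModel c.covector p

/-- The differential of the coordinates `(z, ξ)`. -/
def Corner.dcoords (c : Corner Δ) (X : ToricCotangent Δ) :
    ((Fin 2 → ℂ) × ((Fin 2 → ℂ) →L[ℂ] ℂ)) →L[ℂ] ((Fin 2 → ℂ) × (Fin 2 → ℂ)) :=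
  mfderiv cotangentModel 𝓘(ℂ, (Fin 2 → ℂ) × (Fin 2 → ℂ)) c.coords X

theorem Corner.hasMFDerivAt_covector (c : Corner Δ) (p : (Fin 2 → ℂ) × (Fin 2 → ℂ)) :
    HasMFDerivAt 𝓘(ℂ, (Fin 2 → ℂ) × (Fin 2 → ℂ)) cotangentModel c.covector p (c.pushL p) :=
  (c.contMDiff_covector.mdifferentiable (by simp) p).hasMFDerivAt

theorem Corner.hasMFDerivAt_coords (c : Corner Δ) {X : ToricCotangent Δ} (hX : X ∈ c.domain) :
    HasMFDerivAt cotangentModel 𝓘(ℂ, (Fin 2 → ℂ) × (Fin 2 → ℂ)) c.coords X (c.dcoords X) :=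
  ((c.contMDiffOn_coords.contMDiffAt (c.isOpen_domain.mem_nhds hX)).mdifferentiableAt
    (by simp)).hasMFDerivAt

theorem Corner.dcoords_pushL' {c c' : Corner Δ} {p : (Fin 2 → ℂ) × (Fin 2 → ℂ)}
    (hp : p.1 ∈ overlap c.frame c'.frame) :
    (c'.dcoords (c.covector p)).comp (c.pushL p) =
      fderiv ℂ (cotangentTrans c.frame c'.frame) p := by
  have hX : c.covector p ∈ c'.domain := Corner.chart_symm_mem_iff.2 hp
  have h1 := (c'.hasMFDerivAt_coords hX).comp p (c.hasMFDerivAt_covector p)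
  have h2 : c'.coords ∘ c.covector =ᶠ[nhds p] cotangentTrans c.frame c'.frame := by
    filter_upwards [(isOpen_overlap_prod c.frame c'.frame).mem_nhds hp] with q hq
    exact Corner.coords_covector' hq
  rw [← mfderiv_eq_fderiv, ← h2.mfderiv_eq, h1.mfderiv]
  rfl

theorem Corner.dcoords_pushL (c : Corner Δ) (p v : (Fin 2 → ℂ) × (Fin 2 → ℂ)) :
    c.dcoords (c.covector p) (c.pushL p v) = v := by
  have h1 := (c.hasMFDerivAt_coords (c.covector_mem p)).comp p (c.hasMFDerivAt_covector p)
  have h2 : c.coords ∘ c.covector = id := funext c.coords_covector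
  rw [h2] at h1
  exact congrArg (fun f : ((Fin 2 → ℂ) × (Fin 2 → ℂ)) →L[ℂ] ((Fin 2 → ℂ) × (Fin 2 → ℂ)) => f v)
    (h1.mfderiv.symm.trans mfderiv_id)

theorem Corner.pushL_dcoords (c : Corner Δ) (p : (Fin 2 → ℂ) × (Fin 2 → ℂ))
    (v : (Fin 2 → ℂ) × ((Fin 2 → ℂ) →L[ℂ] ℂ)) :
    c.pushL p (c.dcoords (c.covector p) v) = v := by
  have h0 : HasMFDerivAt 𝓘(ℂ, (Fin 2 → ℂ) × (Fin 2 → ℂ)) cotangentModel c.covector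
      (c.coords (c.covector p)) (c.pushL p) := by
    rw [c.coords_covector]; exact c.hasMFDerivAt_covector p
  have h1 := h0.comp (c.covector p) (c.hasMFDerivAt_coords (c.covector_mem p))
  have h2 : c.covector ∘ c.coords =ᶠ[nhds (c.covector p)] id := by
    filter_upwards [c.isOpen_domain.mem_nhds (c.covector_mem p)] with X hX
    exact c.covector_coords hX
  exact congrArg (fun f : ((Fin 2 → ℂ) × ((Fin 2 → ℂ) →L[ℂ] ℂ)) →L[ℂ]
      ((Fin 2 → ℂ) × ((Fin 2 → ℂ) →L[ℂ] ℂ)) => f v)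
    (h1.mfderiv.symm.trans (h2.mfderiv_eq.trans mfderiv_id))

/-- The differential of the parametrisation `Corner.covector`, as an isomorphism. -/
def Corner.pushEquiv (c : Corner Δ) (p : (Fin 2 → ℂ) × (Fin 2 → ℂ)) :
    ((Fin 2 → ℂ) × (Fin 2 → ℂ)) ≃L[ℂ] ((Fin 2 → ℂ) × ((Fin 2 → ℂ) →L[ℂ] ℂ)) :=
  ContinuousLinearEquiv.equivOfInverse (c.pushL p) (c.dcoords (c.covector p)) (c.dcoords_pushL p)
    (c.pushL_dcoords p)

/-- The symplectic form on the cotangent bundle, as a form on the model space. It is defined in the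
preferred patch and has the same expression in all others (`cotangentForm_covector`). -/
def cotangentForm (X : ToricCotangent Δ) :
    ((Fin 2 → ℂ) × ((Fin 2 → ℂ) →L[ℂ] ℂ)) [⋀^Fin 2]→L[ℂ] ℂ :=
  (stdForm (X.1.corner.coords X)).compContinuousLinearMap (X.1.corner.dcoords X)

theorem cotangentForm_covector (c : Corner Δ) (p : (Fin 2 → ℂ) × (Fin 2 → ℂ)) :
    (cotangentForm (c.covector p)).compContinuousLinearMap (c.pushL p) = stdForm p := by
  have hp : p.1 ∈ overlap c.frame (c.covector p).1.corner.frame :=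
    Corner.chart_symm_mem_iff.1 (ToricSurface.mem_source _)
  rw [← stdForm_cotangentTrans hp, ← Corner.dcoords_pushL' hp, ← Corner.coords_covector' hp]
  rfl

theorem cotangentForm_push (c : Corner Δ) (p v w : (Fin 2 → ℂ) × (Fin 2 → ℂ)) :
    cotangentForm (c.covector p) ![c.pushL p v, c.pushL p w] = stdForm p ![v, w] := by
  rw [← cotangentForm_covector]
  simp only [ContinuousAlternatingMap.compContinuousLinearMap_apply]
  congr 1
  ext1 i
  fin_cases i <;> rfl

theorem stdForm_nondegenerate (q v : (Fin 2 → ℂ) × (Fin 2 → ℂ))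
    (h : ∀ w, stdForm q ![v, w] = 0) : v = 0 := by
  have hI : ∀ x : ℂ, -I * x = 0 → x = 0 := fun x hx => by simpa using hx
  have h1 := hI _ ((stdForm_apply q v _).symm.trans (h (0, Pi.single 0 1)))
  have h2 := hI _ ((stdForm_apply q v _).symm.trans (h (0, Pi.single 1 1)))
  have h3 := hI _ ((stdForm_apply q v _).symm.trans (h (Pi.single 0 1, 0)))
  have h4 := hI _ ((stdForm_apply q v _).symm.trans (h (Pi.single 1 1, 0)))
  simp only [Fin.sum_univ_two, Pi.single_eq_same, Pi.zero_apply, ne_eq, one_ne_zero, zero_ne_one,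
    not_false_eq_true, Pi.single_eq_of_ne] at h1 h2 h3 h4
  -- `v` is annihilated by the differentials of both `ξ_a z_a`
  have hp0 : q.2 0 * v.1 0 + v.2 0 * q.1 0 = 0 := by
    linear_combination q.2 0 * h1 - q.1 0 * h3
  have hp1 : q.2 1 * v.1 1 + v.2 1 * q.1 1 = 0 := by
    linear_combination q.2 1 * h2 - q.1 1 * h4
  ext a
  · fin_cases a
    · change v.1 0 = 0
      linear_combination h1 - q.1 0 * hp1
    · change v.1 1 = 0
      linear_combination h2 + q.1 1 * hp0
  · fin_cases a
    · change v.2 0 = 0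
      linear_combination -h3 + q.2 0 * hp1
    · change v.2 1 = 0
      linear_combination -h4 - q.2 1 * hp0

/-- In the preferred charts the form is, up to a linear change of the fibre coordinates, the
standard one. -/
theorem localForm_cotangentForm (X₀ : ToricCotangent Δ)
    (y : (Fin 2 → ℂ) × ((Fin 2 → ℂ) →L[ℂ] ℂ)) :
    localForm (J := cotangentModel) cotangentForm X₀ y =
      (stdForm (modelEquiv.symm y)).compContinuousLinearMap
        (modelEquiv.symm : ((Fin 2 → ℂ) × ((Fin 2 → ℂ) →L[ℂ] ℂ)) →L[ℂ] _) := by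
  have h1 : ((extChartAt cotangentModel X₀).symm : _ → ToricCotangent Δ) =
      X₀.1.corner.covector ∘ modelEquiv.symm := funext (extChartAt_symm X₀)
  have h2 := (X₀.1.corner.hasMFDerivAt_covector (modelEquiv.symm y)).comp y
    (modelEquiv.symm.hasFDerivAt (x := y)).hasMFDerivAt
  change (cotangentForm ((extChartAt cotangentModel X₀).symm y)).compContinuousLinearMap
    (mfderivWithin 𝓘(ℂ, (Fin 2 → ℂ) × ((Fin 2 → ℂ) →L[ℂ] ℂ)) cotangentModel
      (extChartAt cotangentModel X₀).symm (range cotangentModel) y) = _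
  rw [ModelWithCorners.range_eq_univ, mfderivWithin_univ, h1, h2.mfderiv,
    ← cotangentForm_covector X₀.1.corner]
  rfl

theorem contDiff_compContinuousLinearMap {U V W : Type*} [NormedAddCommGroup U] [NormedSpace ℂ U]
    [NormedAddCommGroup V] [NormedSpace ℂ V] [NormedAddCommGroup W] [NormedSpace ℂ W]
    (f : W →L[ℂ] V) {η : U → V [⋀^Fin 2]→L[ℂ] ℂ} (h : ContDiff ℂ ω η) :
    ContDiff ℂ ω fun x => (η x).compContinuousLinearMap f :=
  (ContinuousLinearMap.contDiff (E := V [⋀^Fin 2]→L[ℂ] ℂ) (F := W [⋀^Fin 2]→L[ℂ] ℂ)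
    (ContinuousAlternatingMap.compContinuousLinearMapCLM f)).comp h

variable (Δ) in
/-- The holomorphic symplectic form of the groupoid. -/
def symplecticForm : HolSymplecticForm cotangentModel (ToricCotangent Δ) where
  toFun := cotangentForm
  holomorphic X₀ := by
    have h : localForm (J := cotangentModel) cotangentForm X₀ = _ :=
      funext (localForm_cotangentForm X₀)
    rw [h]
    exact (contDiff_compContinuousLinearMap (modelEquiv.symm :
      ((Fin 2 → ℂ) × ((Fin 2 → ℂ) →L[ℂ] ℂ)) →L[ℂ] ((Fin 2 → ℂ) × (Fin 2 → ℂ)))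
      (contDiff_stdForm.comp modelEquiv.symm.contDiff)).contDiffOn
  closed X₀ y _ := by
    have h : localForm (J := cotangentModel) cotangentForm X₀ = _ :=
      funext (localForm_cotangentForm X₀)
    rw [h, ModelWithCorners.range_eq_univ, extDerivWithin_univ]
    have h1 := extDeriv_pullback (𝕜 := ℂ) (x := y)
      (contDiff_stdForm.differentiable (by simp) (modelEquiv.symm y))
      (modelEquiv.symm.contDiff (n := ω)).contDiffAt le_top
    simp only [ContinuousLinearEquiv.fderiv, extDeriv_stdForm] at h1
    rw [h1]
    rfl
  nondegenerate X v hv := by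
    obtain ⟨c, p, rfl⟩ := X.exists_covector
    obtain ⟨v, rfl⟩ := (c.pushEquiv p).surjective v
    have : v = 0 := stdForm_nondegenerate p v fun w => by
      rw [← cotangentForm_push c]
      exact hv (c.pushEquiv p w)
    rw [this]
    exact (c.pushEquiv p).map_zero

/-! ### The torus action on the toric surface -/

theorem charValue_expScale (E : Matrix.SpecialLinearGroup (Fin 2) ℤ) (s z : Fin 2 → ℂ)
    (m : Fin 2 → ℤ) : charValue E (expScale E s z) m =
      (charValue E z m).map fun v => exp (∑ i, (m i : ℂ) * s i) * v := by
  have h0 : ∀ b, expScale E s z b = 0 ↔ z b = 0 := fun b => by simp [expScale]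
  simp only [charValue, h0]
  split_ifs with h
  · simp only [expScale, mul_zpow, Finset.prod_mul_distrib, prod_exp_zpow, vecMul_exponent,
      Option.map_some]
  · rfl

/-- The action of `exp s`, for `s` in the Lie algebra `ℂ²` of the torus, on the toric surface. -/
def act (s : Fin 2 → ℂ) (x : ToricSurface Δ) : ToricSurface Δ :=
  ⟨fun m => (x.1 m).map fun v => exp (∑ i, (m i : ℂ) * s i) * v, by
    obtain ⟨c, z, h⟩ := x.2
    refine ⟨c, expScale c.frame s z, ?_⟩
    ext1 m
    rw [charValue_expScale, h]⟩

theorem act_chart_symm (c : Corner Δ) (s z : Fin 2 → ℂ) :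
    act s (c.chart.symm z) = c.chart.symm (expScale c.frame s z) :=
  Subtype.ext (funext fun m => (charValue_expScale c.frame s z m).symm)

theorem exists_chart_symm (x : ToricSurface Δ) : ∃ (c : Corner Δ) (z : Fin 2 → ℂ),
    x = c.chart.symm z :=
  ⟨x.corner, x.corner.chart x, (x.corner.chart.left_inv x.mem_source).symm⟩

/-- In coordinates the torus acts by linear maps. -/
def expScaleL (E : Matrix.SpecialLinearGroup (Fin 2) ℤ) (s : Fin 2 → ℂ) :
    (Fin 2 → ℂ) →L[ℂ] (Fin 2 → ℂ) :=
  ContinuousLinearMap.pi fun a => exp (∑ i, (E.1 a i : ℂ) * s i) •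
    ContinuousLinearMap.proj (R := ℂ) (φ := fun _ : Fin 2 => ℂ) a

theorem expScaleL_apply (E : Matrix.SpecialLinearGroup (Fin 2) ℤ) (s z : Fin 2 → ℂ) :
    expScaleL E s z = expScale E s z := by
  ext a; simp [expScaleL, expScale]

theorem Corner.hasMFDerivAt_chart_symm (c : Corner Δ) (z : Fin 2 → ℂ) :
    HasMFDerivAt 𝓘(ℂ, Fin 2 → ℂ) 𝓘(ℂ, Fin 2 → ℂ) c.chart.symm z (c.dsymm z) :=
  (c.mdiff_chart_symm z).hasMFDerivAt

theorem Corner.hasMFDerivAt_chart (c : Corner Δ) {x : ToricSurface Δ} (hx : x ∈ c.chart.source) :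
    HasMFDerivAt 𝓘(ℂ, Fin 2 → ℂ) 𝓘(ℂ, Fin 2 → ℂ) c.chart x (c.dchart x) :=
  (c.mdiff_chart hx).hasMFDerivAt

/-- The differential of the action of `exp s`. -/
def dact (s : Fin 2 → ℂ) (x : ToricSurface Δ) : (Fin 2 → ℂ) →L[ℂ] (Fin 2 → ℂ) :=
  mfderiv 𝓘(ℂ, Fin 2 → ℂ) 𝓘(ℂ, Fin 2 → ℂ) (act s) x

theorem dact_chart_symm (c : Corner Δ) (s z : Fin 2 → ℂ) :
    dact s (c.chart.symm z) = (c.dsymm (expScale c.frame s z)).comp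
      ((expScaleL c.frame s).comp (c.dchart (c.chart.symm z))) := by
  have h0 : c.chart.symm z ∈ c.chart.source := c.chart_symm_mem z
  have h1 : HasMFDerivAt 𝓘(ℂ, Fin 2 → ℂ) 𝓘(ℂ, Fin 2 → ℂ) (expScaleL c.frame s)
      (c.chart (c.chart.symm z)) (expScaleL c.frame s) :=
    (expScaleL c.frame s).hasFDerivAt.hasMFDerivAt
  have h2 := h1.comp _ (c.hasMFDerivAt_chart h0)
  have h3 := c.hasMFDerivAt_chart_symm ((expScaleL c.frame s) (c.chart (c.chart.symm z)))
  have h4 := h3.comp (c.chart.symm z) h2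
  have h5 : c.chart.symm ∘ expScaleL c.frame s ∘ c.chart =ᶠ[nhds (c.chart.symm z)] act s := by
    filter_upwards [c.chart.open_source.mem_nhds h0] with x hx
    have := c.chart.left_inv hx
    conv_rhs => rw [← this, act_chart_symm]
    simp only [Function.comp_apply, expScaleL_apply]
  have h6 : dact s (c.chart.symm z) = _ := (h5.mfderiv_eq.symm.trans h4.mfderiv)
  rw [h6, c.chart_chart_symm, expScaleL_apply]
  rfl

theorem dact_dsymm (c : Corner Δ) (s z v : Fin 2 → ℂ) :
    dact s (c.chart.symm z) (c.dsymm z v) =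
      c.dsymm (expScale c.frame s z) (expScale c.frame s v) := by
  rw [dact_chart_symm]
  simp only [ContinuousLinearMap.comp_apply, c.dchart_dsymm, expScaleL_apply]

/-- The fundamental vector field of `s ∈ ℂ²` for the torus action. -/
def fundamental (s : Fin 2 → ℂ) (x : ToricSurface Δ) : Fin 2 → ℂ :=
  (mfderiv 𝓘(ℂ, ℂ) 𝓘(ℂ, Fin 2 → ℂ) (fun t : ℂ => act (t • s) x) 0 : ℂ →L[ℂ] (Fin 2 → ℂ)) (1 : ℂ)

theorem fundamental_chart_symm (c : Corner Δ) (s z : Fin 2 → ℂ) :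
    fundamental s (c.chart.symm z) =
      c.dsymm z fun a => (∑ i, (c.frame.1 a i : ℂ) * s i) * z a := by
  have h0 : expScale c.frame ((0 : ℂ) • s) z = z := by rw [zero_smul, expScale_zero]
  have h1 := (hasDerivAt_expScale c.frame s z).hasFDerivAt.hasMFDerivAt
  have h2 := c.hasMFDerivAt_chart_symm (expScale c.frame ((0 : ℂ) • s) z)
  have h3 := h2.comp (0 : ℂ) h1
  have h4 : (fun t : ℂ => act (t • s) (c.chart.symm z)) =
      c.chart.symm ∘ fun t : ℂ => expScale c.frame (t • s) z :=
    funext fun t => act_chart_symm c (t • s) z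
  rw [fundamental, h4, h3.mfderiv, h0]
  change c.dsymm z ((1 : ℂ) • _) = _
  rw [one_smul]

/-! ### The Poisson structure -/

/-- The bivector `u ∧ w`. -/
def wedgeVec {V : Type*} [NormedAddCommGroup V] [NormedSpace ℂ V] (u w : V) :
    (V →L[ℂ] ℂ) →ₗ[ℂ] (V →L[ℂ] ℂ) →ₗ[ℂ] ℂ :=
  LinearMap.mk₂ ℂ (fun α β => α u * β w - β u * α w)
    (fun _ _ _ => by simp; ring) (fun _ _ _ => by simp; ring)
    (fun _ _ _ => by simp; ring) (fun _ _ _ => by simp; ring)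

theorem wedgeVec_apply {V : Type*} [NormedAddCommGroup V] [NormedSpace ℂ V] (u w : V)
    (α β : V →L[ℂ] ℂ) : wedgeVec u w α β = α u * β w - β u * α w := rfl

/-- The bivector field `i V₁ ∧ V₂` for the fundamental vector fields `V₁, V₂` of a basis of the Lie
algebra of the torus. -/
def toricBivector (x : ToricSurface Δ) :
    ((Fin 2 → ℂ) →L[ℂ] ℂ) →ₗ[ℂ] ((Fin 2 → ℂ) →L[ℂ] ℂ) →ₗ[ℂ] ℂ :=
  I • wedgeVec (fundamental (Pi.single 0 1) x) (fundamental (Pi.single 1 1) x)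

theorem clm_apply_eq_sum (α : (Fin 2 → ℂ) →L[ℂ] ℂ) (v : Fin 2 → ℂ) :
    α v = v 0 * α (Pi.single 0 1) + v 1 * α (Pi.single 1 1) := by
  conv_lhs => rw [← linForm_single α, linForm_apply]
  rw [Fin.sum_univ_two]
  ring

/-- All frames give the same bivector in coordinates, as they are unimodular. -/
theorem toricBivector_chart_symm (c : Corner Δ) (z : Fin 2 → ℂ) (α β : (Fin 2 → ℂ) →L[ℂ] ℂ) :
    toricBivector (c.chart.symm z) α β = I * z 0 * z 1 *
      (α (c.dsymm z (Pi.single 0 1)) * β (c.dsymm z (Pi.single 1 1)) -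
        β (c.dsymm z (Pi.single 0 1)) * α (c.dsymm z (Pi.single 1 1))) := by
  have hE := det_frame c.frame
  have key : ∀ (γ : (Fin 2 → ℂ) →L[ℂ] ℂ) (v : Fin 2 → ℂ), γ (c.dsymm z v) =
      v 0 * γ (c.dsymm z (Pi.single 0 1)) + v 1 * γ (c.dsymm z (Pi.single 1 1)) := fun γ v =>
    clm_apply_eq_sum (γ.comp (c.dsymm z)) v
  have key' := fun (γ : (Fin 2 → ℂ) →L[ℂ] ℂ) (s : Fin 2 → ℂ) =>
    key γ fun a => (∑ i, (c.frame.1 a i : ℂ) * s i) * z a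
  simp only [toricBivector, LinearMap.smul_apply, wedgeVec_apply, fundamental_chart_symm,
    smul_eq_mul, key']
  simp only [Fin.sum_univ_two, Pi.single_eq_same, ne_eq, one_ne_zero, zero_ne_one,
    not_false_eq_true, Pi.single_eq_of_ne]
  linear_combination (I * z 0 * z 1 *
      (α (c.dsymm z (Pi.single 0 1)) * β (c.dsymm z (Pi.single 1 1)) -
        β (c.dsymm z (Pi.single 0 1)) * α (c.dsymm z (Pi.single 1 1)))) * hE

/-- The Poisson bracket in the coordinates of a patch. -/
def localBracket (F G : (Fin 2 → ℂ) → ℂ) (z : Fin 2 → ℂ) : ℂ :=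
  I * z 0 * z 1 * (fderiv ℂ F z (Pi.single 0 1) * fderiv ℂ G z (Pi.single 1 1) -
    fderiv ℂ G z (Pi.single 0 1) * fderiv ℂ F z (Pi.single 1 1))

theorem contDiffAt_fderiv_apply {F : (Fin 2 → ℂ) → ℂ} {z : Fin 2 → ℂ} (hF : ContDiffAt ℂ ω F z)
    (e : Fin 2 → ℂ) : ContDiffAt ℂ ω (fun w => fderiv ℂ F w e) z :=
  (hF.fderiv_right le_rfl).clm_apply contDiffAt_const

theorem contDiffAt_localBracket {F G : (Fin 2 → ℂ) → ℂ} {z : Fin 2 → ℂ}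
    (hF : ContDiffAt ℂ ω F z) (hG : ContDiffAt ℂ ω G z) : ContDiffAt ℂ ω (localBracket F G) z := by
  have hc : ∀ a, ContDiffAt ℂ ω (fun w : Fin 2 → ℂ => w a) z := fun a =>
    (contDiff_apply ℂ ℂ a).contDiffAt
  exact ((contDiffAt_const.mul (hc 0)).mul (hc 1)).mul
    (((contDiffAt_fderiv_apply hF _).mul (contDiffAt_fderiv_apply hG _)).sub
      ((contDiffAt_fderiv_apply hG _).mul (contDiffAt_fderiv_apply hF _)))

theorem hasFDerivAt_fderiv_apply {F : (Fin 2 → ℂ) → ℂ} {z : Fin 2 → ℂ} (hF : ContDiffAt ℂ ω F z)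
    (e : Fin 2 → ℂ) :
    HasFDerivAt (fun w => fderiv ℂ F w e) ((ContinuousLinearMap.apply ℂ ℂ e).comp
      (fderiv ℂ (fderiv ℂ F) z)) z :=
  (ContinuousLinearMap.apply ℂ ℂ e).hasFDerivAt.comp z
    ((hF.fderiv_right (m := ω) le_rfl).differentiableAt (by simp)).hasFDerivAt

theorem fderiv_localBracket {F G : (Fin 2 → ℂ) → ℂ} {z : Fin 2 → ℂ}
    (hF : ContDiffAt ℂ ω F z) (hG : ContDiffAt ℂ ω G z) (v : Fin 2 → ℂ) :
    fderiv ℂ (localBracket F G) z v =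
      I * (v 0 * z 1 + z 0 * v 1) *
        (fderiv ℂ F z (Pi.single 0 1) * fderiv ℂ G z (Pi.single 1 1) -
          fderiv ℂ F z (Pi.single 1 1) * fderiv ℂ G z (Pi.single 0 1)) +
      I * z 0 * z 1 *
        (fderiv ℂ (fderiv ℂ F) z v (Pi.single 0 1) * fderiv ℂ G z (Pi.single 1 1) +
          fderiv ℂ F z (Pi.single 0 1) * fderiv ℂ (fderiv ℂ G) z v (Pi.single 1 1) -
          fderiv ℂ (fderiv ℂ F) z v (Pi.single 1 1) * fderiv ℂ G z (Pi.single 0 1) -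
          fderiv ℂ F z (Pi.single 1 1) * fderiv ℂ (fderiv ℂ G) z v (Pi.single 0 1)) := by
  have hc : ∀ a, HasFDerivAt (fun w : Fin 2 → ℂ => w a)
      (ContinuousLinearMap.proj (R := ℂ) (φ := fun _ : Fin 2 => ℂ) a) z := fun a =>
    (ContinuousLinearMap.proj (R := ℂ) (φ := fun _ : Fin 2 => ℂ) a).hasFDerivAt
  have h : HasFDerivAt (localBracket F G) _ z := (((hc 0).const_mul I).fun_mul (hc 1)).fun_mul
    (((hasFDerivAt_fderiv_apply hF (Pi.single 0 1)).fun_mul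
      (hasFDerivAt_fderiv_apply hG (Pi.single 1 1))).fun_sub
      ((hasFDerivAt_fderiv_apply hG (Pi.single 0 1)).fun_mul
        (hasFDerivAt_fderiv_apply hF (Pi.single 1 1))))
  rw [h.fderiv]
  simp
  ring

theorem localBracket_jacobi {F G H : (Fin 2 → ℂ) → ℂ} {z : Fin 2 → ℂ}
    (hF : ContDiffAt ℂ ω F z) (hG : ContDiffAt ℂ ω G z) (hH : ContDiffAt ℂ ω H z) :
    localBracket F (localBracket G H) z + localBracket G (localBracket H F) z +
      localBracket H (localBracket F G) z = 0 := by
  have sF := (hF.isSymmSndFDerivAt le_top).eq (Pi.single 0 1) (Pi.single 1 1)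
  have sG := (hG.isSymmSndFDerivAt le_top).eq (Pi.single 0 1) (Pi.single 1 1)
  have sH := (hH.isSymmSndFDerivAt le_top).eq (Pi.single 0 1) (Pi.single 1 1)
  unfold localBracket
  change I * z 0 * z 1 * (_ * fderiv ℂ (localBracket G H) z _ -
      fderiv ℂ (localBracket G H) z _ * _) +
    I * z 0 * z 1 * (_ * fderiv ℂ (localBracket H F) z _ -
      fderiv ℂ (localBracket H F) z _ * _) +
    I * z 0 * z 1 * (_ * fderiv ℂ (localBracket F G) z _ -
      fderiv ℂ (localBracket F G) z _ * _) = 0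
  rw [fderiv_localBracket hG hH, fderiv_localBracket hG hH, fderiv_localBracket hH hF,
    fderiv_localBracket hH hF, fderiv_localBracket hF hG, fderiv_localBracket hF hG, sF, sG, sH]
  simp
  ring

variable (Δ) in
/-- `toricBivector` as a bivector field on the toric surface. -/
def poissonBivector : Bivector 𝓘(ℂ, Fin 2 → ℂ) (ToricSurface Δ) where
  toFun x := toricBivector x
  alt x α := by
    obtain ⟨c, z, rfl⟩ := exists_chart_symm x
    refine (toricBivector_chart_symm c z α α).trans ?_
    ring

theorem contDiffAt_comp_chart_symm (c : Corner Δ) {U : Set (ToricSurface Δ)} (hU : IsOpen U)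
    {f : ToricSurface Δ → ℂ} (hf : ContMDiffOn 𝓘(ℂ, Fin 2 → ℂ) 𝓘(ℂ, ℂ) ω f U) {z : Fin 2 → ℂ}
    (hz : c.chart.symm z ∈ U) : ContDiffAt ℂ ω (f ∘ c.chart.symm) z :=
  ((hf.contMDiffAt (hU.mem_nhds hz)).comp z c.contMDiff_chart_symm.contMDiffAt).contDiffAt

/-- The differential of a function on the toric surface. -/
def dfun (f : ToricSurface Δ → ℂ) (x : ToricSurface Δ) : (Fin 2 → ℂ) →L[ℂ] ℂ :=
  mfderiv 𝓘(ℂ, Fin 2 → ℂ) 𝓘(ℂ, ℂ) f x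

theorem bracket_chart_symm (c : Corner Δ) {U : Set (ToricSurface Δ)} (hU : IsOpen U)
    {f g : ToricSurface Δ → ℂ} (hf : ContMDiffOn 𝓘(ℂ, Fin 2 → ℂ) 𝓘(ℂ, ℂ) ω f U)
    (hg : ContMDiffOn 𝓘(ℂ, Fin 2 → ℂ) 𝓘(ℂ, ℂ) ω g U) {z : Fin 2 → ℂ}
    (hz : c.chart.symm z ∈ U) : (poissonBivector Δ).bracket f g (c.chart.symm z) =
      localBracket (f ∘ c.chart.symm) (g ∘ c.chart.symm) z := by
  have key : ∀ {k : ToricSurface Δ → ℂ}, ContMDiffOn 𝓘(ℂ, Fin 2 → ℂ) 𝓘(ℂ, ℂ) ω k U →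
      ∀ v : Fin 2 → ℂ, dfun k (c.chart.symm z) (c.dsymm z v) = fderiv ℂ (k ∘ c.chart.symm) z v := by
    intro k hk v
    have h1 := ((hk.contMDiffAt (hU.mem_nhds hz)).mdifferentiableAt (by simp)).hasMFDerivAt.comp z
      (c.hasMFDerivAt_chart_symm z)
    rw [← mfderiv_eq_fderiv, h1.mfderiv]
    rfl
  refine (toricBivector_chart_symm c z (dfun f _) (dfun g _)).trans ?_
  rw [key hf, key hf, key hg, key hg]
  rfl

theorem contMDiffOn_bracket {U : Set (ToricSurface Δ)} (hU : IsOpen U)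
    {f g : ToricSurface Δ → ℂ} (hf : ContMDiffOn 𝓘(ℂ, Fin 2 → ℂ) 𝓘(ℂ, ℂ) ω f U)
    (hg : ContMDiffOn 𝓘(ℂ, Fin 2 → ℂ) 𝓘(ℂ, ℂ) ω g U) :
    ContMDiffOn 𝓘(ℂ, Fin 2 → ℂ) 𝓘(ℂ, ℂ) ω ((poissonBivector Δ).bracket f g) U := by
  intro x hx
  obtain ⟨c, z, rfl⟩ := exists_chart_symm x
  refine ContMDiffAt.contMDiffWithinAt ?_
  have h0 := c.chart.open_source.mem_nhds (c.chart_symm_mem z)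
  have h1 := (contDiffAt_localBracket (contDiffAt_comp_chart_symm c hU hf hx)
    (contDiffAt_comp_chart_symm c hU hg hx)).contMDiffAt
  have h2 : ContMDiffAt 𝓘(ℂ, Fin 2 → ℂ) 𝓘(ℂ, ℂ) ω
      (localBracket (f ∘ c.chart.symm) (g ∘ c.chart.symm)) (c.chart (c.chart.symm z)) := by
    rw [c.chart_chart_symm]; exact h1
  refine (h2.comp _ (c.contMDiffOn_chart.contMDiffAt h0)).congr_of_eventuallyEq ?_
  filter_upwards [h0, hU.mem_nhds hx] with y hy hyU
  have hy' := c.chart.left_inv hy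
  rw [Function.comp_apply, ← bracket_chart_symm c hU hf hg (by rwa [hy']), hy']

theorem localBracket_congr {F G G' : (Fin 2 → ℂ) → ℂ} {z : Fin 2 → ℂ} (h : G =ᶠ[nhds z] G') :
    localBracket F G z = localBracket F G' z := by
  unfold localBracket
  rw [h.fderiv_eq]

variable (Δ) in
/-- The holomorphic Poisson structure of the toric surface. -/
def toricPoisson : HolPoisson 𝓘(ℂ, Fin 2 → ℂ) (ToricSurface Δ) where
  toBivector := poissonBivector Δ
  holomorphic _ hU _ _ hf hg := contMDiffOn_bracket hU hf hg
  jacobi U hU f g h hf hg hh x hx := by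
    obtain ⟨c, z, rfl⟩ := exists_chart_symm x
    have hz : ∀ᶠ w in nhds z, c.chart.symm w ∈ U :=
      (c.contMDiff_chart_symm.continuous.isOpen_preimage U hU).mem_nhds hx
    have key : ∀ {k l : ToricSurface Δ → ℂ}, ContMDiffOn 𝓘(ℂ, Fin 2 → ℂ) 𝓘(ℂ, ℂ) ω k U →
        ContMDiffOn 𝓘(ℂ, Fin 2 → ℂ) 𝓘(ℂ, ℂ) ω l U →
        (poissonBivector Δ).bracket k l ∘ c.chart.symm =ᶠ[nhds z]
          localBracket (k ∘ c.chart.symm) (l ∘ c.chart.symm) := by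
      intro k l hk hl
      filter_upwards [hz] with w hw
      exact bracket_chart_symm c hU hk hl hw
    rw [bracket_chart_symm c hU hf (contMDiffOn_bracket hU hg hh) hx,
      bracket_chart_symm c hU hg (contMDiffOn_bracket hU hh hf) hx,
      bracket_chart_symm c hU hh (contMDiffOn_bracket hU hf hg) hx,
      localBracket_congr (key hg hh), localBracket_congr (key hh hf),
      localBracket_congr (key hf hg)]
    exact localBracket_jacobi (contDiffAt_comp_chart_symm c hU hf hx)
      (contDiffAt_comp_chart_symm c hU hg hx) (contDiffAt_comp_chart_symm c hU hh hx)

/-! ### The structure maps of the groupoid -/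

/-- The moment map of the torus action on the cotangent bundle. It is computed in the preferred
patch, but is given by the same formula in all patches (`cotangentMoment_covector`). -/
def cotangentMoment (X : ToricCotangent Δ) : Fin 2 → ℂ :=
  moment X.1.corner.frame (X.1.corner.coords X)

theorem cotangentMoment_covector (c : Corner Δ) (p : (Fin 2 → ℂ) × (Fin 2 → ℂ)) :
    cotangentMoment (c.covector p) = moment c.frame p := by
  have hp : p.1 ∈ overlap c.frame (c.covector p).1.corner.frame :=
    Corner.chart_symm_mem_iff.1 (ToricSurface.mem_source _)
  rw [cotangentMoment, Corner.coords_covector' hp, moment_cotangentTrans hp]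

/-- The torus element by which an arrow moves its source to its target: the moment map, followed by
the isomorphism of the dual of the Lie algebra with the Lie algebra given by the area form. -/
def translation (X : ToricCotangent Δ) : Fin 2 → ℂ :=
  ![cotangentMoment X 1, -cotangentMoment X 0]

/-- The target of an arrow. -/
def target (X : ToricCotangent Δ) : ToricSurface Δ := act (translation X) X.1

/-- The product `h ∘ g`: the covector `h` is pulled back to the source of `g` by the torus action,
and added to `g`. -/
def compose (h g : ToricCotangent Δ) : ToricCotangent Δ :=
  ToricCotangent.mk g.1 (g.form + h.form.comp (dact (translation g) g.1))

/-- The inverse of an arrow. -/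
def inverse (g : ToricCotangent Δ) : ToricCotangent Δ :=
  ToricCotangent.mk (target g) (-g.form.comp (dact (-translation g) (target g)))

/-- The units are the zero covectors. -/
def unitArrow (x : ToricSurface Δ) : ToricCotangent Δ := ToricCotangent.mk x 0

/-- The target in the coordinates of a patch. -/
def localTarget (p : (Fin 2 → ℂ) × (Fin 2 → ℂ)) : Fin 2 → ℂ :=
  ![p.1 0 * exp (p.2 1 * p.1 1), p.1 1 * exp (-(p.2 0 * p.1 0))]

/-- The product in the coordinates of a patch. -/
def localMul (η : Fin 2 → ℂ) (p : (Fin 2 → ℂ) × (Fin 2 → ℂ)) : (Fin 2 → ℂ) × (Fin 2 → ℂ) :=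
  (p.1, ![p.2 0 + η 0 * exp (p.2 1 * p.1 1), p.2 1 + η 1 * exp (-(p.2 0 * p.1 0))])

/-- The inverse in the coordinates of a patch. -/
def localInv (p : (Fin 2 → ℂ) × (Fin 2 → ℂ)) : (Fin 2 → ℂ) × (Fin 2 → ℂ) :=
  (localTarget p, ![-(p.2 0 * exp (-(p.2 1 * p.1 1))), -(p.2 1 * exp (p.2 0 * p.1 0))])

theorem translation_covector (c : Corner Δ) (p : (Fin 2 → ℂ) × (Fin 2 → ℂ)) (a : Fin 2) :
    ∑ i, (c.frame.1 a i : ℂ) * translation (c.covector p) i =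
      ![p.2 1 * p.1 1, -(p.2 0 * p.1 0)] a := by
  have hE := det_frame c.frame
  simp only [translation, cotangentMoment_covector, moment, Fin.sum_univ_two]
  fin_cases a
  · simp
    linear_combination (p.2 1 * p.1 1) * hE
  · simp
    linear_combination (-(p.2 0 * p.1 0)) * hE

theorem expScale_translation (c : Corner Δ) (p : (Fin 2 → ℂ) × (Fin 2 → ℂ)) (v : Fin 2 → ℂ) :
    expScale c.frame (translation (c.covector p)) v =
      ![v 0 * exp (p.2 1 * p.1 1), v 1 * exp (-(p.2 0 * p.1 0))] := by
  ext a
  rw [expScale, translation_covector]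
  fin_cases a <;> simp [mul_comm]

theorem expScale_neg_translation (c : Corner Δ) (p : (Fin 2 → ℂ) × (Fin 2 → ℂ)) (v : Fin 2 → ℂ) :
    expScale c.frame (-translation (c.covector p)) v =
      ![v 0 * exp (-(p.2 1 * p.1 1)), v 1 * exp (p.2 0 * p.1 0)] := by
  ext a
  have h := translation_covector c p a
  simp only [expScale, Pi.neg_apply, mul_neg, Finset.sum_neg_distrib, h]
  fin_cases a <;> simp [mul_comm]

theorem target_covector (c : Corner Δ) (p : (Fin 2 → ℂ) × (Fin 2 → ℂ)) :
    target (c.covector p) = c.chart.symm (localTarget p) := by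
  rw [target, Corner.covector_fst, act_chart_symm, expScale_translation]
  rfl

/-- A covector over the patch of a corner is determined by its values on the coordinate vector
fields. -/
theorem mk_eq_covector (c : Corner Δ) (z ξ : Fin 2 → ℂ) (α : (Fin 2 → ℂ) →L[ℂ] ℂ)
    (h : ∀ v, α (c.dsymm z v) = ∑ a, ξ a * v a) :
    ToricCotangent.mk (c.chart.symm z) α = c.covector (z, ξ) := by
  refine ToricCotangent.ext' rfl ?_
  change α = _
  ext v
  have hv := c.dsymm_dchart (c.chart_symm_mem z) v
  rw [c.chart_chart_symm] at hv
  rw [← hv, h, c.form_covector_dsymm (z, ξ)]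

theorem compose_covector (c : Corner Δ) (p : (Fin 2 → ℂ) × (Fin 2 → ℂ)) (η : Fin 2 → ℂ) :
    compose (c.covector (localTarget p, η)) (c.covector p) = c.covector (localMul η p) := by
  refine mk_eq_covector c p.1 _ _ fun v => ?_
  have h : c.dsymm (expScale c.frame (translation (c.covector p)) p.1) =
      c.dsymm (localTarget p, η).1 := by rw [expScale_translation]; rfl
  rw [add_apply, ContinuousLinearMap.comp_apply, c.form_covector_dsymm,
    Corner.covector_fst, dact_dsymm, h, c.form_covector_dsymm, expScale_translation]
  simp [Fin.sum_univ_two]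
  ring

theorem inverse_covector (c : Corner Δ) (p : (Fin 2 → ℂ) × (Fin 2 → ℂ)) :
    inverse (c.covector p) = c.covector (localInv p) := by
  rw [inverse, target_covector]
  refine mk_eq_covector c _ _ _ fun v => ?_
  have h : expScale c.frame (-translation (c.covector p)) (localTarget p) = p.1 := by
    rw [expScale_neg_translation]
    ext a
    fin_cases a <;> simp [localTarget, mul_assoc, ← exp_add]
  rw [neg_apply, ContinuousLinearMap.comp_apply, dact_dsymm, h, c.form_covector_dsymm,
    expScale_neg_translation]
  simp [Fin.sum_univ_two]
  ring

theorem unitArrow_chart_symm (c : Corner Δ) (z : Fin 2 → ℂ) :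
    unitArrow (c.chart.symm z) = c.covector (z, 0) :=
  mk_eq_covector c z 0 0 fun v => by simp

/-- Composable arrows lie over a common patch. -/
theorem exists_composable (c : Corner Δ) {h : ToricCotangent Δ}
    {p : (Fin 2 → ℂ) × (Fin 2 → ℂ)} (hh : h.1 = target (c.covector p)) :
    ∃ η, h = c.covector (localTarget p, η) := by
  rw [target_covector] at hh
  have h1 : h.1 ∈ c.chart.source := by rw [hh]; exact c.chart_symm_mem _
  refine ⟨(c.coords h).2, ?_⟩
  conv_lhs => rw [← c.covector_coords h1]
  have h2 : (c.coords h).1 = localTarget p := by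
    rw [Corner.coords, hh, c.chart_chart_symm]
  rw [← h2]

/-! ### The groupoid axioms -/

theorem localTarget_localMul (η : Fin 2 → ℂ) (p : (Fin 2 → ℂ) × (Fin 2 → ℂ)) :
    localTarget (localMul η p) = localTarget (localTarget p, η) := by
  ext a
  fin_cases a
  · simp only [localTarget, localMul, Fin.zero_eta, Matrix.cons_val_zero, Matrix.cons_val_one]
    rw [mul_assoc, ← exp_add]
    ring_nf
  · simp only [localTarget, localMul, Fin.mk_one, Matrix.cons_val_zero, Matrix.cons_val_one]
    rw [mul_assoc, ← exp_add]
    ring_nf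

theorem localMul_assoc (θ η : Fin 2 → ℂ) (p : (Fin 2 → ℂ) × (Fin 2 → ℂ)) :
    localMul (localMul θ (localTarget p, η)).2 p = localMul θ (localMul η p) := by
  refine Prod.ext rfl ?_
  ext a
  fin_cases a
  · simp only [localTarget, localMul, Fin.zero_eta, Matrix.cons_val_zero, Matrix.cons_val_one]
    rw [add_mul _ _ (p.1 1), exp_add]
    ring_nf
  · simp only [localTarget, localMul, Fin.mk_one, Matrix.cons_val_zero, Matrix.cons_val_one]
    rw [add_mul _ _ (p.1 0), neg_add, exp_add]
    ring_nf

theorem localTarget_localInv (p : (Fin 2 → ℂ) × (Fin 2 → ℂ)) : localTarget (localInv p) = p.1 := by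
  have h0 := exp_add (p.2 1 * p.1 1) (-(p.2 1 * p.1 1))
  have h1 := exp_add (p.2 0 * p.1 0) (-(p.2 0 * p.1 0))
  rw [add_neg_cancel, exp_zero] at h0 h1
  ext a
  fin_cases a
  · have h2 : -(p.2 1 * exp (p.2 0 * p.1 0)) * (p.1 1 * exp (-(p.2 0 * p.1 0))) =
        -(p.2 1 * p.1 1) := by linear_combination (p.2 1 * p.1 1) * h1
    simp only [localTarget, localInv, Fin.zero_eta, Matrix.cons_val_zero, Matrix.cons_val_one, h2]
    linear_combination -(p.1 0) * h0
  · have h2 : -(-(p.2 0 * exp (-(p.2 1 * p.1 1))) * (p.1 0 * exp (p.2 1 * p.1 1))) =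
        p.2 0 * p.1 0 := by linear_combination -(p.2 0 * p.1 0) * h0
    simp only [localTarget, localInv, Fin.mk_one, Matrix.cons_val_zero, Matrix.cons_val_one, h2]
    linear_combination -(p.1 1) * h1

theorem localMul_localInv (p : (Fin 2 → ℂ) × (Fin 2 → ℂ)) : localMul (localInv p).2 p =
    (p.1, 0) := by
  have h0 := exp_add (p.2 1 * p.1 1) (-(p.2 1 * p.1 1))
  have h1 := exp_add (p.2 0 * p.1 0) (-(p.2 0 * p.1 0))
  rw [add_neg_cancel, exp_zero] at h0 h1
  refine Prod.ext rfl ?_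
  ext a
  fin_cases a
  · simp only [localInv, localMul, Fin.zero_eta, Matrix.cons_val_zero, Matrix.cons_val_one,
      Pi.zero_apply]
    linear_combination (p.2 0) * h0
  · simp only [localInv, localMul, Fin.mk_one, Matrix.cons_val_zero, Matrix.cons_val_one,
      Pi.zero_apply]
    linear_combination (p.2 1) * h1

theorem localInv_localInv (p : (Fin 2 → ℂ) × (Fin 2 → ℂ)) : localInv (localInv p) = p := by
  have h0 := exp_add (p.2 1 * p.1 1) (-(p.2 1 * p.1 1))
  have h1 := exp_add (p.2 0 * p.1 0) (-(p.2 0 * p.1 0))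
  rw [add_neg_cancel, exp_zero] at h0 h1
  refine Prod.ext (localTarget_localInv p) ?_
  ext a
  fin_cases a
  · have h2 : -(-(p.2 1 * exp (p.2 0 * p.1 0)) * (p.1 1 * exp (-(p.2 0 * p.1 0)))) =
        p.2 1 * p.1 1 := by linear_combination -(p.2 1 * p.1 1) * h1
    simp only [localTarget, localInv, Fin.zero_eta, Matrix.cons_val_zero, Matrix.cons_val_one, h2]
    linear_combination -(p.2 0) * h0
  · have h2 : -(p.2 0 * exp (-(p.2 1 * p.1 1))) * (p.1 0 * exp (p.2 1 * p.1 1)) =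
        -(p.2 0 * p.1 0) := by linear_combination (p.2 0 * p.1 0) * h0
    simp only [localTarget, localInv, Fin.mk_one, Matrix.cons_val_zero, Matrix.cons_val_one, h2]
    linear_combination -(p.2 1) * h1

theorem target_unitArrow (x : ToricSurface Δ) : target (unitArrow x) = x := by
  obtain ⟨c, z, rfl⟩ := exists_chart_symm x
  rw [unitArrow_chart_symm, target_covector]
  congr 1
  ext a
  fin_cases a <;> simp [localTarget]

theorem target_inverse (g : ToricCotangent Δ) : target (inverse g) = g.1 := by
  obtain ⟨c, p, rfl⟩ := g.exists_covector
  rw [inverse_covector, target_covector, localTarget_localInv, Corner.covector_fst]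

theorem inverse_inverse (g : ToricCotangent Δ) : inverse (inverse g) = g := by
  obtain ⟨c, p, rfl⟩ := g.exists_covector
  rw [inverse_covector, inverse_covector, localInv_localInv]

theorem target_compose (h g : ToricCotangent Δ) (hg : h.1 = target g) :
    target (compose h g) = target h := by
  obtain ⟨c, p, rfl⟩ := g.exists_covector
  obtain ⟨η, rfl⟩ := exists_composable c hg
  rw [compose_covector, target_covector, target_covector, localTarget_localMul]

theorem compose_assoc (k h g : ToricCotangent Δ) (hk : k.1 = target h) (hg : h.1 = target g) :
    compose (compose k h) g = compose k (compose h g) := by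
  obtain ⟨c, p, rfl⟩ := g.exists_covector
  obtain ⟨η, rfl⟩ := exists_composable c hg
  obtain ⟨θ, rfl⟩ := exists_composable c hk
  have h1 := compose_covector c p (localMul θ (localTarget p, η)).2
  have h2 := compose_covector c (localMul η p) θ
  rw [localTarget_localMul] at h2
  rw [compose_covector c (localTarget p, η) θ, compose_covector c p η, h2, ← localMul_assoc, ← h1]
  rfl

theorem compose_unitArrow (g : ToricCotangent Δ) : compose g (unitArrow g.1) = g := by
  obtain ⟨c, p, rfl⟩ := g.exists_covector
  have h := compose_covector c (p.1, 0) p.2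
  have h1 : localTarget (p.1, 0) = p.1 := by
    ext a; fin_cases a <;> simp [localTarget]
  have h2 : localMul p.2 (p.1, 0) = p := by
    refine Prod.ext rfl ?_
    ext a; fin_cases a <;> simp [localMul]
  rw [h1, h2] at h
  rw [Corner.covector_fst, unitArrow_chart_symm]
  exact h

theorem unitArrow_compose (g : ToricCotangent Δ) : compose (unitArrow (target g)) g = g := by
  obtain ⟨c, p, rfl⟩ := g.exists_covector
  rw [target_covector, unitArrow_chart_symm, compose_covector]
  congr 1
  refine Prod.ext rfl ?_
  ext a; fin_cases a <;> simp [localMul]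

theorem inverse_compose (g : ToricCotangent Δ) : compose (inverse g) g = unitArrow g.1 := by
  obtain ⟨c, p, rfl⟩ := g.exists_covector
  have h := compose_covector c p (localInv p).2
  rw [localMul_localInv] at h
  rw [inverse_covector, Corner.covector_fst, unitArrow_chart_symm, ← h]
  rfl

theorem compose_inverse (g : ToricCotangent Δ) : compose g (inverse g) = unitArrow (target g) := by
  have h := inverse_compose (inverse g)
  rwa [inverse_inverse] at h

/-! ### The structure maps are holomorphic -/

theorem contDiff_localTarget : ContDiff ℂ ω localTarget := by
  unfold localTarget
  rw [contDiff_pi]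
  intro a
  fin_cases a
  · simp only [Fin.zero_eta, Matrix.cons_val_zero]
    fun_prop
  · simp only [Fin.mk_one, Matrix.cons_val_one, Matrix.cons_val_zero]
    fun_prop

theorem contDiff_localInv : ContDiff ℂ ω localInv := by
  refine contDiff_localTarget.prodMk ?_
  rw [contDiff_pi]
  intro a
  fin_cases a
  · simp only [Fin.zero_eta, Matrix.cons_val_zero]
    fun_prop
  · simp only [Fin.mk_one, Matrix.cons_val_one, Matrix.cons_val_zero]
    fun_prop

theorem contDiff_localMul : ContDiff ℂ ω
    fun x : (Fin 2 → ℂ) × ((Fin 2 → ℂ) × (Fin 2 → ℂ)) => localMul x.1 x.2 := by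
  refine ContDiff.prodMk (by fun_prop) ?_
  rw [contDiff_pi]
  intro a
  fin_cases a
  · simp only [Fin.zero_eta, Matrix.cons_val_zero]
    fun_prop
  · simp only [Fin.mk_one, Matrix.cons_val_one, Matrix.cons_val_zero]
    fun_prop

theorem Corner.contMDiffAt_coords (c : Corner Δ) {X : ToricCotangent Δ} (hX : X ∈ c.domain) :
    ContMDiffAt cotangentModel 𝓘(ℂ, (Fin 2 → ℂ) × (Fin 2 → ℂ)) ω c.coords X :=
  c.contMDiffOn_coords.contMDiffAt (c.isOpen_domain.mem_nhds hX)

/-- A map on the cotangent bundle is holomorphic if it is so in the coordinates of all patches. -/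
theorem contMDiff_of_comp_covector {E H N : Type*} [NormedAddCommGroup E] [NormedSpace ℂ E]
    [TopologicalSpace H] {K : ModelWithCorners ℂ E H} [TopologicalSpace N] [ChartedSpace H N]
    {f : ToricCotangent Δ → N}
    (h : ∀ c : Corner Δ, ContMDiff 𝓘(ℂ, (Fin 2 → ℂ) × (Fin 2 → ℂ)) K ω (f ∘ c.covector)) :
    ContMDiff cotangentModel K ω f := by
  intro X
  have hX : X ∈ X.1.corner.domain := X.1.mem_source
  refine (((h X.1.corner).contMDiffAt).comp X
    (X.1.corner.contMDiffAt_coords hX)).congr_of_eventuallyEq ?_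
  filter_upwards [X.1.corner.isOpen_domain.mem_nhds hX] with Y hY
  exact (congrArg f (X.1.corner.covector_coords hY)).symm

theorem contMDiff_target : ContMDiff cotangentModel 𝓘(ℂ, Fin 2 → ℂ) ω (target (Δ := Δ)) := by
  refine contMDiff_of_comp_covector fun c => ?_
  have h : target ∘ c.covector = c.chart.symm ∘ localTarget := funext (target_covector c)
  rw [h]
  exact c.contMDiff_chart_symm.comp contDiff_localTarget.contMDiff

theorem contMDiff_inverse : ContMDiff cotangentModel cotangentModel ω (inverse (Δ := Δ)) := by
  refine contMDiff_of_comp_covector fun c => ?_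
  have h : inverse ∘ c.covector = c.covector ∘ localInv := funext (inverse_covector c)
  rw [h]
  exact c.contMDiff_covector.comp contDiff_localInv.contMDiff

theorem contMDiff_source : ContMDiff cotangentModel 𝓘(ℂ, Fin 2 → ℂ) ω
    (fun X : ToricCotangent Δ => X.1) :=
  Bundle.contMDiff_proj _

theorem contMDiff_unitArrow :
    ContMDiff 𝓘(ℂ, Fin 2 → ℂ) cotangentModel ω (unitArrow (Δ := Δ)) :=
  Bundle.contMDiff_zeroSection ℂ (fun x : ToricSurface Δ =>
    TangentSpace 𝓘(ℂ, Fin 2 → ℂ) x →L[ℂ] Bundle.Trivial (ToricSurface Δ) ℂ x)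

theorem contMDiffOn_compose : ContMDiffOn (cotangentModel.prod cotangentModel) cotangentModel ω
    (fun p : ToricCotangent Δ × ToricCotangent Δ => compose p.1 p.2)
    {p | p.1.1 = target p.2} := by
  rintro ⟨h, g⟩ hg
  obtain ⟨c, p, rfl⟩ := g.exists_covector
  obtain ⟨η, rfl⟩ := exists_composable c hg
  have h1 : ContMDiffAt (cotangentModel.prod cotangentModel) 𝓘(ℂ, (Fin 2 → ℂ) × (Fin 2 → ℂ)) ω
      (fun q : ToricCotangent Δ × ToricCotangent Δ => c.coords q.1)
      (c.covector (localTarget p, η), c.covector p) :=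
    ContMDiffAt.comp (g := c.coords) (f := Prod.fst) _ (c.contMDiffAt_coords (c.covector_mem _))
      contMDiffAt_fst
  have h2 : ContMDiffAt (cotangentModel.prod cotangentModel) 𝓘(ℂ, (Fin 2 → ℂ) × (Fin 2 → ℂ)) ω
      (fun q : ToricCotangent Δ × ToricCotangent Δ => c.coords q.2)
      (c.covector (localTarget p, η), c.covector p) :=
    ContMDiffAt.comp (g := c.coords) (f := Prod.snd) _ (c.contMDiffAt_coords (c.covector_mem _))
      contMDiffAt_snd
  have h3 := (contDiff_snd (𝕜 := ℂ) (E := Fin 2 → ℂ) (F := Fin 2 → ℂ)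
    (n := ω)).contMDiff.contMDiffAt.comp _ h1
  have h4 := c.contMDiff_covector.contMDiffAt.comp _
    (contDiff_localMul.contMDiff.contMDiffAt.comp _ (h3.prodMk_space h2))
  have key : ∀ q ∈ {q : ToricCotangent Δ × ToricCotangent Δ | q.1.1 = target q.2},
      q.2 ∈ c.domain → compose q.1 q.2 = c.covector (localMul (c.coords q.1).2 (c.coords q.2)) := by
    rintro ⟨h, g⟩ hq hg
    obtain ⟨p, rfl⟩ : ∃ p, g = c.covector p := ⟨_, (c.covector_coords hg).symm⟩
    obtain ⟨η, rfl⟩ := exists_composable c hq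
    simp only [compose_covector, c.coords_covector]
  refine h4.contMDiffWithinAt.congr_of_eventuallyEq ?_ (key _ hg (c.covector_mem p))
  have h5 : (fun q : ToricCotangent Δ × ToricCotangent Δ => q.2) ⁻¹' c.domain ∈
      nhds (c.covector (localTarget p, η), c.covector p) :=
    (c.isOpen_domain.preimage continuous_snd).mem_nhds (c.covector_mem p)
  filter_upwards [self_mem_nhdsWithin, mem_nhdsWithin_of_mem_nhds h5] with q hq hq'
  exact key q hq hq'

/-! ### The differentials of the structure maps -/

theorem mfderiv_source_covector (c : Corner Δ) (p v : (Fin 2 → ℂ) × (Fin 2 → ℂ)) :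
    (mfderiv cotangentModel 𝓘(ℂ, Fin 2 → ℂ) (fun X : ToricCotangent Δ => X.1) (c.covector p) :
      ((Fin 2 → ℂ) × ((Fin 2 → ℂ) →L[ℂ] ℂ)) →L[ℂ] (Fin 2 → ℂ)) (c.pushL p v) =
        c.dsymm p.1 v.1 := by
  have h1 := (contMDiff_source.mdifferentiable (by simp) (c.covector p)).hasMFDerivAt.comp p
    (c.hasMFDerivAt_covector p)
  have h2 := (c.hasMFDerivAt_chart_symm p.1).comp p (hasFDerivAt_fst (p := p)).hasMFDerivAt
  have h3 : (fun X : ToricCotangent Δ => X.1) ∘ c.covector = c.chart.symm ∘ Prod.fst := rfl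
  rw [h3] at h1
  exact congrArg (fun f : ((Fin 2 → ℂ) × (Fin 2 → ℂ)) →L[ℂ] (Fin 2 → ℂ) => f v)
    (h1.mfderiv.symm.trans h2.mfderiv)

theorem mfderiv_target_covector (c : Corner Δ) (p v : (Fin 2 → ℂ) × (Fin 2 → ℂ)) :
    (mfderiv cotangentModel 𝓘(ℂ, Fin 2 → ℂ) target (c.covector p) :
      ((Fin 2 → ℂ) × ((Fin 2 → ℂ) →L[ℂ] ℂ)) →L[ℂ] (Fin 2 → ℂ)) (c.pushL p v) =
        c.dsymm (localTarget p) (fderiv ℂ localTarget p v) := by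
  have h1 := (contMDiff_target.mdifferentiable (by simp) (c.covector p)).hasMFDerivAt.comp p
    (c.hasMFDerivAt_covector p)
  have h2 := (c.hasMFDerivAt_chart_symm (localTarget p)).comp p
    (contDiff_localTarget.differentiable (by simp) p).hasFDerivAt.hasMFDerivAt
  have h3 : target ∘ c.covector = c.chart.symm ∘ localTarget := funext (target_covector c)
  rw [h3] at h1
  exact congrArg (fun f : ((Fin 2 → ℂ) × (Fin 2 → ℂ)) →L[ℂ] (Fin 2 → ℂ) => f v)
    (h1.mfderiv.symm.trans h2.mfderiv)

theorem Corner.dsymm_injective (c : Corner Δ) (z : Fin 2 → ℂ) : Function.Injective (c.dsymm z) :=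
  Function.LeftInverse.injective (c.dchart_dsymm z)

theorem Corner.dsymm_surjective (c : Corner Δ) (z : Fin 2 → ℂ) :
    Function.Surjective (c.dsymm z) := fun v => by
  have h := c.dsymm_dchart (c.chart_symm_mem z) v
  rw [c.chart_chart_symm] at h
  exact ⟨_, h⟩

theorem surjective_mfderiv_source (g : ToricCotangent Δ) : Function.Surjective
    (mfderiv cotangentModel 𝓘(ℂ, Fin 2 → ℂ) (fun X : ToricCotangent Δ => X.1) g) := by
  obtain ⟨c, p, rfl⟩ := g.exists_covector
  intro v
  obtain ⟨w, hw⟩ := c.dsymm_surjective p.1 v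
  exact ⟨c.pushL p (w, 0), (mfderiv_source_covector c p (w, 0)).trans hw⟩

theorem surjective_fderiv_localTarget (p : (Fin 2 → ℂ) × (Fin 2 → ℂ)) :
    Function.Surjective (fderiv ℂ localTarget p) := by
  intro w
  -- the target after the inversion is the source, which is a submersion
  have h0 : HasFDerivAt localTarget (fderiv ℂ localTarget p) (localInv (localInv p)) := by
    rw [localInv_localInv]
    exact (contDiff_localTarget.differentiable (by simp) p).hasFDerivAt
  have h1 := h0.comp _ (contDiff_localInv.differentiable (by simp) (localInv p)).hasFDerivAt
  have h2 : localTarget ∘ localInv = Prod.fst := funext localTarget_localInv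
  rw [h2] at h1
  exact ⟨_, congrArg (fun f => f (w, 0)) (h1.unique hasFDerivAt_fst)⟩

theorem surjective_mfderiv_target (g : ToricCotangent Δ) : Function.Surjective
    (mfderiv cotangentModel 𝓘(ℂ, Fin 2 → ℂ) target g) := by
  obtain ⟨c, p, rfl⟩ := g.exists_covector
  intro v
  obtain ⟨w, hw⟩ := c.dsymm_surjective (localTarget p) v
  obtain ⟨u, rfl⟩ := surjective_fderiv_localTarget p w
  exact ⟨c.pushL p u, (mfderiv_target_covector c p u).trans hw⟩

/-- The differential of the function `ξ_a z_a` at `p`, evaluated at `v`. -/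
def dweight (p v : (Fin 2 → ℂ) × (Fin 2 → ℂ)) (a : Fin 2) : ℂ := v.2 a * p.1 a + p.2 a * v.1 a

theorem fderiv_localTarget (p v : (Fin 2 → ℂ) × (Fin 2 → ℂ)) : fderiv ℂ localTarget p v =
    ![exp (p.2 1 * p.1 1) * (v.1 0 + p.1 0 * dweight p v 1),
      exp (-(p.2 0 * p.1 0)) * (v.1 1 - p.1 1 * dweight p v 0)] := by
  have hd := contDiff_localTarget.differentiable (by simp) p
  have hw : ∀ a, HasFDerivAt (fun q : (Fin 2 → ℂ) × (Fin 2 → ℂ) => q.2 a * q.1 a) _ p := fun a =>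
    (hasFDerivAt_snd_apply a p).fun_mul (hasFDerivAt_fst_apply a p)
  have h0 : HasFDerivAt (fun q => localTarget q 0) _ p :=
    (hasFDerivAt_fst_apply 0 p).fun_mul (hw 1).cexp
  have h1 : HasFDerivAt (fun q => localTarget q 1) _ p :=
    (hasFDerivAt_fst_apply 1 p).fun_mul (hw 0).fun_neg.cexp
  ext a
  fin_cases a
  · have h := congrArg (fun f => f v) ((fderiv_apply hd 0).symm.trans h0.fderiv)
    refine Eq.trans h ?_
    simp [dzL_apply, dξL_apply, dweight]
    ring
  · have h := congrArg (fun f => f v) ((fderiv_apply hd 1).symm.trans h1.fderiv)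
    refine Eq.trans h ?_
    simp [dzL_apply, dξL_apply, dweight]
    ring

/-! ### Multiplicativity of the symplectic form -/

theorem differentiableAt_localMul {V : Type*} [NormedAddCommGroup V] [NormedSpace ℂ V]
    {A B : V → (Fin 2 → ℂ) × (Fin 2 → ℂ)} {u : V} (hA : DifferentiableAt ℂ A u)
    (hB : DifferentiableAt ℂ B u) : DifferentiableAt ℂ (fun y => localMul (A y).2 (B y)) u :=
  DifferentiableAt.comp
    (g := fun x : (Fin 2 → ℂ) × ((Fin 2 → ℂ) × (Fin 2 → ℂ)) => localMul x.1 x.2) u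
    (contDiff_localMul.differentiable (by simp) ((A u).2, B u)) (hA.snd.prodMk hB)

theorem fderiv_localMul {V : Type*} [NormedAddCommGroup V] [NormedSpace ℂ V]
    {A B : V → (Fin 2 → ℂ) × (Fin 2 → ℂ)} {u : V} (hA : DifferentiableAt ℂ A u)
    (hB : DifferentiableAt ℂ B u) (e : V) :
    fderiv ℂ (fun y => localMul (A y).2 (B y)) u e = ((fderiv ℂ B u e).1,
      ![(fderiv ℂ B u e).2 0 + exp ((B u).2 1 * (B u).1 1) *
          ((fderiv ℂ A u e).2 0 + (A u).2 0 * dweight (B u) (fderiv ℂ B u e) 1),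
        (fderiv ℂ B u e).2 1 + exp (-((B u).2 0 * (B u).1 0)) *
          ((fderiv ℂ A u e).2 1 - (A u).2 1 * dweight (B u) (fderiv ℂ B u e) 0)]) := by
  have hd := differentiableAt_localMul hA hB
  have h1 := fun a => (hasFDerivAt_fst_apply a (B u)).comp u hB.hasFDerivAt
  have h2 := fun a => (hasFDerivAt_snd_apply a (B u)).comp u hB.hasFDerivAt
  have h3 := fun a => (hasFDerivAt_snd_apply a (A u)).comp u hA.hasFDerivAt
  have hw := fun a => (h2 a).fun_mul (h1 a)
  have k0 : HasFDerivAt (fun y => (localMul (A y).2 (B y)).2 0) _ u :=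
    (h2 0).fun_add ((h3 0).fun_mul (hw 1).cexp)
  have k1 : HasFDerivAt (fun y => (localMul (A y).2 (B y)).2 1) _ u :=
    (h2 1).fun_add ((h3 1).fun_mul (hw 0).fun_neg.cexp)
  have l := fun a => (hasFDerivAt_snd_apply a _).comp u hd.hasFDerivAt
  have m : HasFDerivAt (fun y => (B y).1) _ u :=
    HasFDerivAt.comp (g := Prod.fst) (f := fun y => localMul (A y).2 (B y)) u hasFDerivAt_fst
      hd.hasFDerivAt
  have m' : HasFDerivAt (fun y => (B y).1) _ u :=
    (hasFDerivAt_fst (p := B u)).comp u hB.hasFDerivAt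
  refine Prod.ext ?_ ?_
  · exact congrArg (fun f => f e) (m.unique m')
  · ext a
    fin_cases a
    · refine Eq.trans (congrArg (fun f => f e) ((l 0).unique k0)) ?_
      simp [dzL_apply, dξL_apply, dweight]
      ring
    · refine Eq.trans (congrArg (fun f => f e) ((l 1).unique k1)) ?_
      simp [dzL_apply, dξL_apply, dweight]
      ring

/-- In coordinates the symplectic form is multiplicative: here `A` and `B` are the coordinates of
families of arrows, and `h` says that these are composable. -/
theorem stdForm_localMul {V : Type*} [NormedAddCommGroup V] [NormedSpace ℂ V]
    {A B : V → (Fin 2 → ℂ) × (Fin 2 → ℂ)} {u : V} (hA : DifferentiableAt ℂ A u)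
    (hB : DifferentiableAt ℂ B u) (h : ∀ᶠ y in nhds u, (A y).1 = localTarget (B y)) (e e' : V) :
    stdForm (localMul (A u).2 (B u)) ![fderiv ℂ (fun y => localMul (A y).2 (B y)) u e,
        fderiv ℂ (fun y => localMul (A y).2 (B y)) u e'] =
      stdForm (A u) ![fderiv ℂ A u e, fderiv ℂ A u e'] +
        stdForm (B u) ![fderiv ℂ B u e, fderiv ℂ B u e'] := by
  have key : ∀ e, (fderiv ℂ A u e).1 = fderiv ℂ localTarget (B u) (fderiv ℂ B u e) := fun e => by
    have h1 := (hasFDerivAt_fst (p := A u)).comp u hA.hasFDerivAt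
    have h2 := (contDiff_localTarget.differentiable (by simp) (B u)).hasFDerivAt.comp u
      hB.hasFDerivAt
    exact congrArg (fun f => f e) (h1.unique (h2.congr_of_eventuallyEq h))
  simp only [stdForm_apply, fderiv_localMul hA hB, key, fderiv_localTarget, h.self_of_nhds]
  simp only [Fin.sum_univ_two, localTarget, localMul, dweight, Matrix.cons_val_zero,
    Matrix.cons_val_one]
  ring

/-- The symplectic form on a family that is given in coordinates. -/
theorem symplecticForm_family {V : Type*} [NormedAddCommGroup V] [NormedSpace ℂ V] {u : V}
    (c : Corner Δ) {f : V → ToricCotangent Δ} {F : V → (Fin 2 → ℂ) × (Fin 2 → ℂ)}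
    (hF : DifferentiableAt ℂ F u) (hf : f =ᶠ[nhds u] fun y => c.covector (F y)) (e e' : V) :
    (symplecticForm Δ).toFun (f u) ![mfderiv 𝓘(ℂ, V) cotangentModel f u e,
      mfderiv 𝓘(ℂ, V) cotangentModel f u e'] =
        stdForm (F u) ![fderiv ℂ F u e, fderiv ℂ F u e'] := by
  have h1 := (c.hasMFDerivAt_covector (F u)).comp u hF.hasFDerivAt.hasMFDerivAt
  have h2 : (mfderiv 𝓘(ℂ, V) cotangentModel f u : V →L[ℂ] _) = _ :=
    hf.mfderiv_eq.trans h1.mfderiv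
  have h3 : f u = c.covector (F u) := hf.self_of_nhds
  rw [← cotangentForm_push c, ← h3]
  change cotangentForm (f u) _ = _
  congr 1
  have h4 : ∀ e, mfderiv 𝓘(ℂ, V) cotangentModel f u e = c.pushL (F u) (fderiv ℂ F u e) :=
    fun e => congrArg (fun f : V →L[ℂ] ((Fin 2 → ℂ) × ((Fin 2 → ℂ) →L[ℂ] ℂ)) => f e) h2
  exact congrArg₂ (fun x y : (Fin 2 → ℂ) × ((Fin 2 → ℂ) →L[ℂ] ℂ) => ![x, y]) (h4 e) (h4 e')

theorem multiplicative_compose (k : ℕ) (U : Set (Fin k → ℂ)) (hU : IsOpen U)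
    (a b : (Fin k → ℂ) → ToricCotangent Δ)
    (ha : ContMDiffOn 𝓘(ℂ, Fin k → ℂ) cotangentModel ω a U)
    (hb : ContMDiffOn 𝓘(ℂ, Fin k → ℂ) cotangentModel ω b U)
    (hab : ∀ u ∈ U, (a u).1 = target (b u)) (u : Fin k → ℂ) (hu : u ∈ U) (e e' : Fin k → ℂ) :
    (symplecticForm Δ).toFun (compose (a u) (b u))
        ![mfderiv 𝓘(ℂ, Fin k → ℂ) cotangentModel (fun y => compose (a y) (b y)) u e,
          mfderiv 𝓘(ℂ, Fin k → ℂ) cotangentModel (fun y => compose (a y) (b y)) u e'] =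
      (symplecticForm Δ).toFun (a u)
        ![mfderiv 𝓘(ℂ, Fin k → ℂ) cotangentModel a u e,
          mfderiv 𝓘(ℂ, Fin k → ℂ) cotangentModel a u e'] +
      (symplecticForm Δ).toFun (b u)
        ![mfderiv 𝓘(ℂ, Fin k → ℂ) cotangentModel b u e,
          mfderiv 𝓘(ℂ, Fin k → ℂ) cotangentModel b u e'] := by
  have hUn := hU.mem_nhds hu
  obtain ⟨c, p, hp⟩ := (b u).exists_covector
  have hbu : b u ∈ c.domain := by rw [hp]; exact c.covector_mem p
  have hau : a u ∈ c.domain := by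
    have := hab u hu
    rw [hp] at this
    obtain ⟨η, hη⟩ := exists_composable c this
    rw [hη]; exact c.covector_mem _
  have hac := (ha.contMDiffAt hUn)
  have hbc := (hb.contMDiffAt hUn)
  have hA : DifferentiableAt ℂ (c.coords ∘ a) u :=
    (((c.contMDiffAt_coords hau).comp u hac).contDiffAt).differentiableAt (by simp)
  have hB : DifferentiableAt ℂ (c.coords ∘ b) u :=
    (((c.contMDiffAt_coords hbu).comp u hbc).contDiffAt).differentiableAt (by simp)
  have eb : b =ᶠ[nhds u] fun y => c.covector ((c.coords ∘ b) y) := by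
    filter_upwards [hbc.continuousAt.preimage_mem_nhds (c.isOpen_domain.mem_nhds hbu)] with y hy
    exact (c.covector_coords hy).symm
  have ea : a =ᶠ[nhds u] fun y => c.covector ((c.coords ∘ a) y) := by
    filter_upwards [hac.continuousAt.preimage_mem_nhds (c.isOpen_domain.mem_nhds hau)] with y hy
    exact (c.covector_coords hy).symm
  have eA : ∀ᶠ y in nhds u, ((c.coords ∘ a) y).1 = localTarget ((c.coords ∘ b) y) := by
    filter_upwards [ea, eb, hUn] with y hya hyb hy
    have h := hab y hy
    rw [hya, hyb, target_covector, Corner.covector_fst] at h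
    have h' := congrArg c.chart h
    rwa [c.chart_chart_symm, c.chart_chart_symm] at h'
  have em : (fun y => compose (a y) (b y)) =ᶠ[nhds u]
      fun y => c.covector (localMul ((c.coords ∘ a) y).2 ((c.coords ∘ b) y)) := by
    filter_upwards [ea, eb, eA] with y hya hyb hy
    rw [hya, hyb, ← compose_covector, ← hy]
  rw [symplecticForm_family c hA ea, symplecticForm_family c hB eb, ← stdForm_localMul hA hB eA]
  exact symplecticForm_family c (differentiableAt_localMul hA hB) em e e'

variable (Δ) in
/-- The symplectic groupoid on the cotangent bundle of a toric surface. -/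
def toricGroupoid : HolSymplecticGroupoid 𝓘(ℂ, Fin 2 → ℂ) (ToricSurface Δ) cotangentModel
    (ToricCotangent Δ) where
  src X := X.1
  tgt := target
  unit := unitArrow
  inv := inverse
  mul := compose
  src_unit _ := rfl
  tgt_unit := target_unitArrow
  src_inv _ := rfl
  tgt_inv := target_inverse
  src_mul _ _ _ := rfl
  tgt_mul := target_compose
  mul_assoc := compose_assoc
  mul_unit := compose_unitArrow
  unit_mul := unitArrow_compose
  mul_inv := compose_inverse
  inv_mul := inverse_compose
  holomorphic_src := contMDiff_source
  holomorphic_tgt := contMDiff_target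
  holomorphic_unit := contMDiff_unitArrow
  holomorphic_inv := contMDiff_inverse
  holomorphic_mul := contMDiffOn_compose
  submersion_src := surjective_mfderiv_source
  submersion_tgt := surjective_mfderiv_target
  form := symplecticForm Δ
  multiplicative := multiplicative_compose

/-! ### The inverse of the symplectic form -/

/-- The inverse of the symplectic form, in terms of the coordinate vector fields `e a = ∂/∂z_a` and
`f a = ∂/∂ξ_a` of a patch. -/
def Corner.bivector (c : Corner Δ) (p : (Fin 2 → ℂ) × (Fin 2 → ℂ)) :
    (((Fin 2 → ℂ) × ((Fin 2 → ℂ) →L[ℂ] ℂ)) →L[ℂ] ℂ) →ₗ[ℂ]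
      (((Fin 2 → ℂ) × ((Fin 2 → ℂ) →L[ℂ] ℂ)) →L[ℂ] ℂ) →ₗ[ℂ] ℂ :=
  let e : Fin 2 → (Fin 2 → ℂ) × ((Fin 2 → ℂ) →L[ℂ] ℂ) := fun a => c.pushL p (Pi.single a 1, 0)
  let f : Fin 2 → (Fin 2 → ℂ) × ((Fin 2 → ℂ) →L[ℂ] ℂ) := fun a => c.pushL p (0, Pi.single a 1)
  I • (wedgeVec (f 0) (e 0) + wedgeVec (f 1) (e 1) - (p.2 0 * p.2 1) • wedgeVec (f 0) (f 1) +
    (p.2 0 * p.1 1) • wedgeVec (f 0) (e 1) - (p.2 1 * p.1 0) • wedgeVec (f 1) (e 0) -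
    (p.1 0 * p.1 1) • wedgeVec (e 0) (e 1))

theorem clm_prod_apply_eq_sum (α : ((Fin 2 → ℂ) × (Fin 2 → ℂ)) →L[ℂ] ℂ)
    (v : (Fin 2 → ℂ) × (Fin 2 → ℂ)) :
    α v = v.1 0 * α (Pi.single 0 1, 0) + v.1 1 * α (Pi.single 1 1, 0) +
      (v.2 0 * α (0, Pi.single 0 1) + v.2 1 * α (0, Pi.single 1 1)) := by
  have h1 := clm_apply_eq_sum (α.comp (ContinuousLinearMap.inl ℂ (Fin 2 → ℂ) (Fin 2 → ℂ))) v.1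
  have h2 := clm_apply_eq_sum (α.comp (ContinuousLinearMap.inr ℂ (Fin 2 → ℂ) (Fin 2 → ℂ))) v.2
  simp only [ContinuousLinearMap.comp_apply, ContinuousLinearMap.inl_apply,
    ContinuousLinearMap.inr_apply] at h1 h2
  rw [← h1, ← h2, ← map_add]
  simp

theorem Corner.bivector_self (c : Corner Δ) (p : (Fin 2 → ℂ) × (Fin 2 → ℂ))
    (α : ((Fin 2 → ℂ) × ((Fin 2 → ℂ) →L[ℂ] ℂ)) →L[ℂ] ℂ) : c.bivector p α α = 0 := by
  simp only [Corner.bivector, LinearMap.smul_apply, LinearMap.add_apply, LinearMap.sub_apply,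
    wedgeVec_apply, smul_eq_mul]
  ring

/-- If `α = Ω(v, ·)`, then the bivector pairs `α` with `β` to `β v`. -/
theorem bivector_apply_of_eq (c : Corner Δ) (p v : (Fin 2 → ℂ) × (Fin 2 → ℂ))
    (α β : ((Fin 2 → ℂ) × ((Fin 2 → ℂ) →L[ℂ] ℂ)) →L[ℂ] ℂ)
    (h : ∀ w, α (c.pushL p w) = stdForm p ![v, w]) : c.bivector p α β = β (c.pushL p v) := by
  have hβ := clm_prod_apply_eq_sum (β.comp (c.pushL p)) v
  simp only [ContinuousLinearMap.comp_apply] at hβ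
  rw [hβ]
  simp only [Corner.bivector, LinearMap.smul_apply, LinearMap.add_apply, LinearMap.sub_apply,
    wedgeVec_apply, h, stdForm_apply, smul_eq_mul]
  simp only [Fin.sum_univ_two, Pi.single_eq_same, Pi.zero_apply, ne_eq, one_ne_zero, zero_ne_one,
    not_false_eq_true, Pi.single_eq_of_ne]
  generalize β (c.pushL p (Pi.single 0 1, 0)) = b0
  generalize β (c.pushL p (Pi.single 1 1, 0)) = b1
  generalize β (c.pushL p (0, Pi.single 0 1)) = b2
  generalize β (c.pushL p (0, Pi.single 1 1)) = b3
  linear_combination (-(v.1 0 * b0 + v.1 1 * b1 + (v.2 0 * b2 + v.2 1 * b3))) * I_sq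

/-- Every covector is of the form `Ω(v, ·)`. -/
theorem exists_stdForm_eq (p : (Fin 2 → ℂ) × (Fin 2 → ℂ))
    (α : ((Fin 2 → ℂ) × (Fin 2 → ℂ)) →L[ℂ] ℂ) : ∃ v, ∀ w, α w = stdForm p ![v, w] := by
  set a0 := α (Pi.single 0 1, 0) with h0
  set a1 := α (Pi.single 1 1, 0) with h1
  set b0 := α (0, Pi.single 0 1) with h2
  set b1 := α (0, Pi.single 1 1) with h3
  refine ⟨(![I * (b0 - p.2 1 * p.1 0 * b1 + p.1 0 * p.1 1 * a1),
      I * (b1 + p.2 0 * p.1 1 * b0 - p.1 0 * p.1 1 * a0)],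
    ![I * (-a0 + p.2 0 * p.2 1 * b1 - p.2 0 * p.1 1 * a1),
      I * (-a1 - p.2 0 * p.2 1 * b0 + p.2 1 * p.1 0 * a0)]), fun w => ?_⟩
  rw [clm_prod_apply_eq_sum α w, stdForm_apply, ← h0, ← h1, ← h2, ← h3]
  simp only [Fin.sum_univ_two, Matrix.cons_val_zero, Matrix.cons_val_one]
  linear_combination (w.1 0 * a0 + w.1 1 * a1 + (w.2 0 * b0 + w.2 1 * b1)) * I_sq

theorem bivector_apply_of_cotangentForm (c : Corner Δ) (p : (Fin 2 → ℂ) × (Fin 2 → ℂ))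
    (v : (Fin 2 → ℂ) × ((Fin 2 → ℂ) →L[ℂ] ℂ))
    (α β : ((Fin 2 → ℂ) × ((Fin 2 → ℂ) →L[ℂ] ℂ)) →L[ℂ] ℂ)
    (h : ∀ w, α w = cotangentForm (c.covector p) ![v, w]) : c.bivector p α β = β v := by
  obtain ⟨v, rfl⟩ := (c.pushEquiv p).surjective v
  exact bivector_apply_of_eq c p v α β fun w => (h _).trans (cotangentForm_push c p v w)

/-- The bivectors of the patches agree on overlaps, since they are inverse to the symplectic
form. -/
theorem bivector_eq (c c' : Corner Δ) {p p' : (Fin 2 → ℂ) × (Fin 2 → ℂ)}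
    (h : c.covector p = c'.covector p') : c.bivector p = c'.bivector p' := by
  refine LinearMap.ext fun α => LinearMap.ext fun β => ?_
  obtain ⟨v, hv⟩ := exists_stdForm_eq p (α.comp (c.pushL p))
  have h1 : ∀ w, α w = cotangentForm (c.covector p) ![c.pushL p v, w] := fun w => by
    obtain ⟨w, rfl⟩ := (c.pushEquiv p).surjective w
    exact (hv w).trans (cotangentForm_push c p v w).symm
  rw [bivector_apply_of_cotangentForm c p _ α β h1]
  rw [h] at h1
  rw [bivector_apply_of_cotangentForm c' p' _ α β h1]

variable (Δ) in
/-- The inverse of the symplectic form of the groupoid. -/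
def cotangentBivector : Bivector cotangentModel (ToricCotangent Δ) where
  toFun X := X.1.corner.bivector (X.1.corner.coords X)
  alt X α := X.1.corner.bivector_self (X.1.corner.coords X) α

theorem cotangentBivector_covector (c : Corner Δ) (p : (Fin 2 → ℂ) × (Fin 2 → ℂ)) :
    (cotangentBivector Δ).toFun (c.covector p) = c.bivector p :=
  bivector_eq _ c (Corner.covector_coords _ (ToricSurface.mem_source _))

theorem isInverse_cotangentBivector : IsInverse (cotangentBivector Δ) (symplecticForm Δ) := by
  intro X v α β h
  obtain ⟨c, p, rfl⟩ := X.exists_covector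
  rw [cotangentBivector_covector]
  exact bivector_apply_of_cotangentForm c p v α β h

/-! ### Source and target as Poisson maps -/

/-- The differential of the target. -/
def dtarget (X : ToricCotangent Δ) : ((Fin 2 → ℂ) × ((Fin 2 → ℂ) →L[ℂ] ℂ)) →L[ℂ] (Fin 2 → ℂ) :=
  mfderiv cotangentModel 𝓘(ℂ, Fin 2 → ℂ) target X

/-- The differential of the source. -/
def dsource (X : ToricCotangent Δ) : ((Fin 2 → ℂ) × ((Fin 2 → ℂ) →L[ℂ] ℂ)) →L[ℂ] (Fin 2 → ℂ) :=
  mfderiv cotangentModel 𝓘(ℂ, Fin 2 → ℂ) (fun X : ToricCotangent Δ => X.1) X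

theorem comp_dtarget_pushL (c : Corner Δ) (p v : (Fin 2 → ℂ) × (Fin 2 → ℂ))
    (α : (Fin 2 → ℂ) →L[ℂ] ℂ) : α.comp (dtarget (c.covector p)) (c.pushL p v) =
      exp (p.2 1 * p.1 1) * (v.1 0 + p.1 0 * dweight p v 1) *
          α (c.dsymm (localTarget p) (Pi.single 0 1)) +
        exp (-(p.2 0 * p.1 0)) * (v.1 1 - p.1 1 * dweight p v 0) *
          α (c.dsymm (localTarget p) (Pi.single 1 1)) := by
  have h : dtarget (c.covector p) (c.pushL p v) = _ := mfderiv_target_covector c p v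
  rw [ContinuousLinearMap.comp_apply, h, fderiv_localTarget]
  exact clm_apply_eq_sum (α.comp (c.dsymm (localTarget p))) _

theorem comp_dsource_pushL (c : Corner Δ) (p v : (Fin 2 → ℂ) × (Fin 2 → ℂ))
    (α : (Fin 2 → ℂ) →L[ℂ] ℂ) : α.comp (dsource (c.covector p)) (c.pushL p v) =
      v.1 0 * α (c.dsymm p.1 (Pi.single 0 1)) + v.1 1 * α (c.dsymm p.1 (Pi.single 1 1)) := by
  have h : dsource (c.covector p) (c.pushL p v) = _ := mfderiv_source_covector c p v
  rw [ContinuousLinearMap.comp_apply, h]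
  exact clm_apply_eq_sum (α.comp (c.dsymm p.1)) _

theorem bivector_comp_dtarget (c : Corner Δ) (p : (Fin 2 → ℂ) × (Fin 2 → ℂ))
    (α β : (Fin 2 → ℂ) →L[ℂ] ℂ) :
    c.bivector p (α.comp (dtarget (c.covector p))) (β.comp (dtarget (c.covector p))) =
      toricBivector (target (c.covector p)) α β := by
  rw [target_covector, toricBivector_chart_symm]
  simp only [Corner.bivector, LinearMap.smul_apply, LinearMap.add_apply, LinearMap.sub_apply,
    wedgeVec_apply, comp_dtarget_pushL, smul_eq_mul]
  simp only [localTarget, dweight, Pi.single_eq_same, Pi.zero_apply, ne_eq, one_ne_zero,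
    zero_ne_one, not_false_eq_true, Pi.single_eq_of_ne, Matrix.cons_val_zero, Matrix.cons_val_one]
  ring

theorem bivector_comp_dsource (c : Corner Δ) (p : (Fin 2 → ℂ) × (Fin 2 → ℂ))
    (α β : (Fin 2 → ℂ) →L[ℂ] ℂ) :
    c.bivector p (α.comp (dsource (c.covector p))) (β.comp (dsource (c.covector p))) =
      -toricBivector (c.chart.symm p.1) α β := by
  rw [toricBivector_chart_symm]
  simp only [Corner.bivector, LinearMap.smul_apply, LinearMap.add_apply, LinearMap.sub_apply,
    wedgeVec_apply, comp_dsource_pushL, smul_eq_mul]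
  simp only [Pi.single_eq_same, Pi.zero_apply, ne_eq, one_ne_zero,
    zero_ne_one, not_false_eq_true, Pi.single_eq_of_ne]
  ring

theorem dtarget_eq_zero_iff (X : ToricCotangent Δ)
    (v : (Fin 2 → ℂ) × ((Fin 2 → ℂ) →L[ℂ] ℂ)) :
    dtarget X v = 0 ↔ ∀ w, dsource X w = 0 → cotangentForm X ![v, w] = 0 := by
  obtain ⟨c, p, rfl⟩ := X.exists_covector
  obtain ⟨v, rfl⟩ := (c.pushEquiv p).surjective v
  have ht : dtarget (c.covector p) (c.pushL p v) = _ := mfderiv_target_covector c p v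
  have hs : ∀ w, dsource (c.covector p) (c.pushL p w) = c.dsymm p.1 w.1 :=
    mfderiv_source_covector c p
  have h1 : dtarget (c.covector p) (c.pushEquiv p v) = 0 ↔
      v.1 0 + p.1 0 * dweight p v 1 = 0 ∧ v.1 1 - p.1 1 * dweight p v 0 = 0 := by
    refine Iff.trans (b := c.dsymm (localTarget p) (fderiv ℂ localTarget p v) = 0)
      (by rw [← ht]; rfl) ?_
    rw [map_eq_zero_iff _ (c.dsymm_injective _), fderiv_localTarget]
    simp [funext_iff, Fin.forall_fin_two]
  -- the vertical vectors are the kernel of the differential of the source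
  have h2 : ∀ η : Fin 2 → ℂ, cotangentForm (c.covector p) ![c.pushEquiv p v, c.pushL p (0, η)] =
      -I * (η 0 * (v.1 0 + p.1 0 * dweight p v 1) + η 1 * (v.1 1 - p.1 1 * dweight p v 0)) := by
    intro η
    refine (cotangentForm_push c p v (0, η)).trans ?_
    rw [stdForm_apply]
    simp only [Fin.sum_univ_two, dweight, Pi.zero_apply]
    ring
  rw [h1]
  constructor
  · rintro ⟨h3, h4⟩ w hw
    obtain ⟨⟨w, η⟩, rfl⟩ := (c.pushEquiv p).surjective w
    obtain rfl : w = 0 := c.dsymm_injective p.1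
      (((hs (w, η)).symm.trans hw).trans (map_zero _).symm)
    refine (h2 η).trans ?_
    rw [h3, h4]
    ring
  · intro h
    have h3 := fun η => (h2 η).symm.trans (h _ ((hs (0, η)).trans (map_zero _)))
    have h4 := h3 (Pi.single 0 1)
    have h5 := h3 (Pi.single 1 1)
    simp only [Pi.single_eq_same, ne_eq, one_ne_zero, zero_ne_one, not_false_eq_true,
      Pi.single_eq_of_ne, one_mul, zero_mul, add_zero, zero_add, mul_eq_zero, neg_eq_zero,
      I_ne_zero, false_or] at h4 h5
    exact ⟨h4, h5⟩

/-! ### The fibres of source and target -/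

/-- The fibres of the source are the cotangent spaces. -/
def sourceFibreHomeomorph (c : Corner Δ) (z : Fin 2 → ℂ) :
    (Fin 2 → ℂ) ≃ₜ ((fun X : ToricCotangent Δ => X.1) ⁻¹' {c.chart.symm z}) where
  toFun ξ := ⟨c.covector (z, ξ), rfl⟩
  invFun X := (c.coords X.1).2
  left_inv ξ := by simp only [c.coords_covector]
  right_inv X := by
    obtain ⟨X, hX⟩ := X
    change X.1 = c.chart.symm z at hX
    obtain ⟨η, rfl⟩ : ∃ η, X = c.covector (z, η) := by
      have hX' : X.1 ∈ c.chart.source := by rw [hX]; exact c.chart_symm_mem z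
      refine ⟨(c.coords X).2, ?_⟩
      conv_lhs => rw [← c.covector_coords hX']
      have h2 : (c.coords X).1 = z := by rw [Corner.coords, hX, c.chart_chart_symm]
      rw [← h2]
    simp only [c.coords_covector]
  continuous_toFun := by
    refine Continuous.subtype_mk ?_ _
    exact c.contMDiff_covector.continuous.comp (by fun_prop)
  continuous_invFun := by
    have h : ∀ X : (fun X : ToricCotangent Δ => X.1) ⁻¹' {c.chart.symm z}, X.1 ∈ c.domain :=
      fun X => by
        have hX : X.1.1 = c.chart.symm z := X.2
        change X.1.1 ∈ c.chart.source
        rw [hX]; exact c.chart_symm_mem z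
    exact continuous_snd.comp (c.contMDiffOn_coords.continuousOn.comp_continuous
      continuous_subtype_val h)

theorem contractibleSpace_source_fibre (m : ToricSurface Δ) :
    ContractibleSpace ((fun X : ToricCotangent Δ => X.1) ⁻¹' {m}) := by
  obtain ⟨c, z, rfl⟩ := exists_chart_symm m
  exact (sourceFibreHomeomorph c z).symm.contractibleSpace

/-- The inversion exchanges the fibres of source and target. -/
def targetFibreHomeomorph (m : ToricSurface Δ) :
    (target ⁻¹' {m}) ≃ₜ ((fun X : ToricCotangent Δ => X.1) ⁻¹' {m}) where
  toFun X := ⟨inverse X.1, X.2⟩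
  invFun X := ⟨inverse X.1, (target_inverse X.1).trans X.2⟩
  left_inv X := Subtype.ext (inverse_inverse X.1)
  right_inv X := Subtype.ext (inverse_inverse X.1)
  continuous_toFun := (contMDiff_inverse.continuous.comp continuous_subtype_val).subtype_mk _
  continuous_invFun := (contMDiff_inverse.continuous.comp continuous_subtype_val).subtype_mk _

theorem contractibleSpace_target_fibre (m : ToricSurface Δ) :
    ContractibleSpace (target ⁻¹' {m}) :=
  have := contractibleSpace_source_fibre m
  (targetFibreHomeomorph m).contractibleSpace

theorem toricGroupoid_integrates :
    (toricGroupoid Δ).Integrates (cotangentBivector Δ) (toricPoisson Δ) where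
  inverse := isInverse_cotangentBivector
  tgt_poisson g α β := by
    obtain ⟨c, p, rfl⟩ := g.exists_covector
    rw [cotangentBivector_covector]
    exact bivector_comp_dtarget c p α β
  src_antiPoisson g α β := by
    obtain ⟨c, p, rfl⟩ := g.exists_covector
    rw [cotangentBivector_covector]
    exact bivector_comp_dsource c p α β
  simplyConnected_src m :=
    have : ContractibleSpace ((toricGroupoid Δ).src ⁻¹' {m}) := contractibleSpace_source_fibre m
    inferInstance
  simplyConnected_tgt m :=
    have : ContractibleSpace ((toricGroupoid Δ).tgt ⁻¹' {m}) := contractibleSpace_target_fibre m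
    inferInstance
  orthogonal g v := dtarget_eq_zero_iff g v

end ToricPoisson

end

open ToricPoisson Complex
/-- The holomorphic Poisson structure `σ = i z₁ z₂ ∂/∂z₁ ∧ ∂/∂z₂` of the toric surface of a Delzant
polygon integrates to a holomorphic symplectic groupoid on the holomorphic cotangent bundle, with
the explicit structure below. The coordinates `z₁, z₂, ξ₁, ξ₂` are `z 0, z 1, ξ 0, ξ 1`. -/
theorem mainTheorem3 (Δ : Set (Fin 2 → ℝ)) (hΔ : IsDelzant Δ) :
    ∃ σ : HolPoisson 𝓘(ℂ, Fin 2 → ℂ) (ToricSurface Δ),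
      (∀ (c : Corner Δ) (z : Fin 2 → ℂ)
        (α β : TangentSpace 𝓘(ℂ, Fin 2 → ℂ) (c.chart.symm z) →L[ℂ] ℂ),
        σ.toFun (c.chart.symm z) α β =
          I * z 0 * z 1 * wedge (c.baseVec z 0) (c.baseVec z 1) α β) ∧
      ∃ (G : HolSymplecticGroupoid 𝓘(ℂ, Fin 2 → ℂ) (ToricSurface Δ)
          cotangentModel (ToricCotangent Δ))
        (P : Bivector cotangentModel (ToricCotangent Δ)),
        G.Integrates P σ ∧
        ∀ (c : Corner Δ) (z ξ : Fin 2 → ℂ),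
          -- the symplectic form
          (∀ v w : (Fin 2 → ℂ) × (Fin 2 → ℂ),
            I * G.form.toFun (c.covector (z, ξ)) ![c.push (z, ξ) v, c.push (z, ξ) w] =
              -(ξ 0 * ξ 1) * wedge (dz 0) (dz 1) v w
              - ξ 0 * z 1 * wedge (dz 0) (dξ 1) v w
              + wedge (dz 0) (dξ 0) v w
              + wedge (dz 1) (dξ 1) v w
              + ξ 1 * z 0 * wedge (dz 1) (dξ 0) v w
              - z 0 * z 1 * wedge (dξ 0) (dξ 1) v w) ∧
          -- its inverse
          (∀ α β : TangentSpace cotangentModel (c.covector (z, ξ)) →L[ℂ] ℂ,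
            -I * P.toFun (c.covector (z, ξ)) α β =
              wedge (c.vecξ (z, ξ) 0) (c.vecZ (z, ξ) 0) α β
              + wedge (c.vecξ (z, ξ) 1) (c.vecZ (z, ξ) 1) α β
              - ξ 0 * ξ 1 * wedge (c.vecξ (z, ξ) 0) (c.vecξ (z, ξ) 1) α β
              + ξ 0 * z 1 * wedge (c.vecξ (z, ξ) 0) (c.vecZ (z, ξ) 1) α β
              - ξ 1 * z 0 * wedge (c.vecξ (z, ξ) 1) (c.vecZ (z, ξ) 0) α β
              - z 0 * z 1 * wedge (c.vecZ (z, ξ) 0) (c.vecZ (z, ξ) 1) α β) ∧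
          -- source, target and multiplication
          G.src (c.covector (z, ξ)) = c.chart.symm z ∧
          G.tgt (c.covector (z, ξ)) =
            c.chart.symm ![z 0 * exp (ξ 1 * z 1), z 1 * exp (-(ξ 0 * z 0))] ∧
          ∀ η : Fin 2 → ℂ,
            G.mul (c.covector (![z 0 * exp (ξ 1 * z 1), z 1 * exp (-(ξ 0 * z 0))], η))
                (c.covector (z, ξ)) =
              c.covector (z, ![ξ 0 + η 0 * exp (ξ 1 * z 1), ξ 1 + η 1 * exp (-(ξ 0 * z 0))]) := by
  refine ⟨toricPoisson Δ, fun c z α β => toricBivector_chart_symm c z α β, toricGroupoid Δ,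
    cotangentBivector Δ, toricGroupoid_integrates, fun c z ξ => ⟨fun v w => ?_, fun α β => ?_, rfl,
      target_covector c (z, ξ), fun η => compose_covector c (z, ξ) η⟩⟩
  · have h : (toricGroupoid Δ).form.toFun (c.covector (z, ξ)) ![c.push (z, ξ) v, c.push (z, ξ) w] =
        stdForm (z, ξ) ![v, w] := cotangentForm_push c (z, ξ) v w
    rw [h, stdForm_apply]
    simp only [Fin.sum_univ_two, wedge, dz, dξ]
    linear_combination (-(v.1 0 * w.2 0 - v.2 0 * w.1 0 + (v.1 1 * w.2 1 - v.2 1 * w.1 1) -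
      ((ξ 0 * v.1 0 + v.2 0 * z 0) * (ξ 1 * w.1 1 + w.2 1 * z 1) -
        (ξ 1 * v.1 1 + v.2 1 * z 1) * (ξ 0 * w.1 0 + w.2 0 * z 0)))) * I_sq
  · rw [cotangentBivector_covector]
    have hI : -I * I = 1 := by rw [neg_mul, I_mul_I, neg_neg]
    have h : ∀ x : ℂ, -I * (I * x) = x := fun x => by rw [← mul_assoc, hI, one_mul]
    exact h _
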